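/- **Setting.** Let $(E,d)$ be a metric space, $A\subsetneq E$, $\Delta>0$ and $\alpha\in(0,1)$. A *$\Delta$-subdivision* is a Lebesgue measurable map $\rho$ with bounded image from an open interval $(a_\rho,a_\rho+\Delta)$ to $E$ (values in $A$ are allowed). Put $$D^\alpha_\Delta(\rho,q)=\int_{a_\rho}^{a_\rho+\Delta}\bigl[(1-\alpha)\,d\bigl(\rho(t),q(t+a_q-a_\rho)\bigr)+\alpha\,|a_q-a_\rho|\bigr]dt,\qquad D^\alpha_\Delta(\rho,A)=\int_{a_\rho}^{a_\rho+\Delta}(1-\alpha)\,d(\rho(t),A)\,dt .$$ Let $\bar{\mathcal S}^\Delta$ be the set of functions $P$ from a union of $N_P\ge 1$ disjoint open intervals of length $\Delta$, numbered from left to right, to $E$ whose restrictions $P_1,\dots,P_{N_P}$ to these intervals are $\Delta$-subdivisions. For $P,Q\in\bar{\mathcal S}^\Delta$, a *partial assignment* is a strictly increasing map $f$ from a subset $\operatorname{dom} f$ of $\{1,\dots,N_P\}$ to $\{1,\dots,N_Q\}$. Set $$L_D(f)=\sum_{i\notin\operatorname{dom}f}D^\alpha_\Delta(P_i,A),\quad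 L_S(f)=\sum_{i\in\operatorname{dom}f}D^\alpha_\Delta(P_i,Q_{f(i)}),\quad L_I(f)=\sum_{j\notin\operatorname{Im}f}D^\alpha_\Delta(Q_j,A),$$ and $\mathrm{CED}^\Delta_{\alpha,1}(P,Q)=\min_f\bigl(L_D(f)+L_S(f)+L_I(f)\bigr)$; $f$ is *optimal* if it attains this minimum. Let $\mathcal S^\Delta$ denote the metric space obtained from $(\bar{\mathcal S}^\Delta,\mathrm{CED}^\Delta_{\alpha,1})$ by identifying elements at distance zero, and $[P]\in\mathcal S^\Delta$ the class of $P$. A *geodesic* from $x$ to $y$ in a metric space $(X,d)$ is a continuous map $\gamma:[0,d(x,y)]\to X$ with $\gamma(0)=x$, $\gamma(d(x,y))=y$ and length (supremum over partitions of the sums of consecutive distances) equal to $d(x,y)$; the space is *geodesic* if any two of its points are joined by a geodesic. **Theorem.** Suppose that $(E,d)$ is a geodesic Polish space (separable, with completely metrizable topology), and that $A\subsetneq E$ is closed and such that for every $x\in E$ there is $y\in A$ with $d(x,y)=d(x,A)$. Then $(\mathcal S^\Delta,\mathrm{CED}^\Delta_{\alpha,1})$ is a geodesic space. Moreover, for all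 $P,Q\in\bar{\mathcal S}^\Delta$ and every optimal partial assignment $f$ between them, put $L_1=L_D(f)$, $L_2=L_1+L_S(f)$ and $L_3=L_2+L_I(f)=\mathrm{CED}^\Delta_{\alpha,1}(P,Q)$. Then there is a geodesic $\gamma:[0,L_3]\to\mathcal S^\Delta$ from $[P]$ to $[Q]$ of the following form. * There are $\Delta$-subdivisions $p^i$ ($i\notin\operatorname{dom}f$) and $q^j$ ($j\notin\operatorname{Im}f$) on the same intervals as $P_i$ and $Q_j$, such that for almost every $t$ the points $p^i(t)$ and $q^j(t)$ are nearest points of $A$ to $P_i(t)$ and $Q_j(t)$. * There are paths $(G_i^T)_{T\in[0,1]}$ from $P_i$ to $p^i$ ($i\notin\operatorname{dom}f$), $(G_{i,f(i)}^T)_{T\in[0,1]}$ from $P_i$ to $Q_{f(i)}$ ($i\in\operatorname{dom}f$), and $(H_j^T)_{T\in[0,1]}$ from $q^j$ to $Q_j$ ($j\notin\operatorname{Im}f$), all of which are constant-speed $D^\alpha_\Delta$-geodesics of $\Delta$-subdivisions, along which the left end point of the interval is affine in $T$ and, for almost every $u\in(0,\Delta)$, the value at (left end point) $+\,u$ moves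 along a constant-speed geodesic of $E$. * (Delete.) For $l\in[0,L_1]$, $\gamma(l)$ is the class of the sequence $P$ in which $P_i$ is replaced by $G_i^{l/L_1}$ for every $i\notin\operatorname{dom}f$. * (Substitute.) If $\operatorname{dom}f\neq\emptyset$, then for $l\in[L_1,L_2]$, $\gamma(l)$ is the class of the sequence of the $G_{i,f(i)}^{(l-L_1)/(L_2-L_1)}$, $i\in\operatorname{dom}f$, in increasing order of $i$. * (Insert.) For $l\in[L_2,L_3]$, $\gamma(l)$ is the class of the sequence $Q$ in which $Q_j$ is replaced by $H_j^{(l-L_2)/(L_3-L_2)}$ for every $j\notin\operatorname{Im}f$. For a stage of length zero the quotient $0/0$ is read as $0$. -/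

import Mathlib

open Set MeasureTheory

/-! ### Geodesics in metric spaces -/

/-- A geodesic from `x` to `y`: a continuous map on `[0, d(x,y)]` from `x` to `y` whose length
(supremum over partitions of the sums of consecutive distances) equals `d(x,y)`.
Only the restriction of `γ` to `[0, d(x,y)]` matters. -/
structure IsGeodesic {X : Type*} [MetricSpace X] (x y : X) (γ : ℝ → X) : Prop where
  continuousOn : ContinuousOn γ (Icc 0 (dist x y))
  source : γ 0 = x
  target : γ (dist x y) = y
  length : eVariationOn γ (Icc 0 (dist x y)) = ENNReal.ofReal (dist x y)

/-- A metric space is geodesic if any two points are joined by a geodesic. -/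
def IsGeodesicSpace (X : Type*) [MetricSpace X] : Prop :=
  ∀ x y : X, ∃ γ : ℝ → X, IsGeodesic x y γ

/-! ### Subdivisions and time-varying diagrams -/

/-- A `Δ`-subdivision: a Lebesgue measurable map with bounded image from an open interval
`(start, start + Δ)` to `E`. The values of `toFun` outside that interval are irrelevant.
`NullMeasurable` is measurability with respect to the completed Borel `σ`-algebra. The values are
allowed to lie in the reference set (relaxed space of subdivisions). -/
structure Subdivision (E : Type*) [MetricSpace E] [MeasurableSpace E] (Δ : ℝ) where
  start : ℝ
  toFun : ℝ → E
  measurable_toFun : NullMeasurable toFun (volume.restrict (Ioo start (start + Δ)))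
  bounded_toFun : Bornology.IsBounded (toFun '' Ioo start (start + Δ))

/-- An `E`-valued time-varying diagram with step `Δ`: a function on the union of `N ≥ 1` disjoint
intervals of length `Δ`, listed from left to right, given by its restrictions `sub i` to them. -/
structure TVPD (E : Type*) [MetricSpace E] [MeasurableSpace E] (Δ : ℝ) where
  N : ℕ
  one_le_N : 1 ≤ N
  sub : Fin N → Subdivision E Δ
  ordered : ∀ i i' : Fin N, i < i' →
    ∀ x ∈ Ioo (sub i).start ((sub i).start + Δ),
    ∀ x' ∈ Ioo (sub i').start ((sub i').start + Δ), x < x'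

/-! ### The local distance and the edit distance -/

namespace Subdivision

variable {E : Type*} [MetricSpace E] [MeasurableSpace E] {Δ : ℝ}

/-- The distance `D^α_Δ(ρ, q)` between two subdivisions. -/
noncomputable def D (α : ℝ) (ρ q : Subdivision E Δ) : ℝ :=
  ∫ t in Ioo ρ.start (ρ.start + Δ),
    ((1 - α) * dist (ρ.toFun t) (q.toFun (t + q.start - ρ.start)) + α * |q.start - ρ.start|)

/-- The distance `D^α_Δ(ρ, A)` from a subdivision to the reference set `A`. -/
noncomputable def DSet (α : ℝ) (A : Set E) (ρ : Subdivision E Δ) : ℝ :=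
  ∫ t in Ioo ρ.start (ρ.start + Δ), (1 - α) * Metric.infDist (ρ.toFun t) A

end Subdivision

/-- A partial assignment between `{1,…,n}` and `{1,…,m}`: a strictly increasing function from a
subset of the first set to the second, given by its graph. -/
@[ext]
structure PartialAssignment (n m : ℕ) where
  graph : Finset (Fin n × Fin m)
  functional : ∀ x ∈ graph, ∀ y ∈ graph, x.1 = y.1 → x.2 = y.2
  strictMono : ∀ x ∈ graph, ∀ y ∈ graph, x.1 < y.1 → x.2 < y.2

namespace PartialAssignment

variable {n m : ℕ}

/-- The domain of a partial assignment. -/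
def dom (f : PartialAssignment n m) : Finset (Fin n) := f.graph.image Prod.fst

/-- The image of a partial assignment. -/
def im (f : PartialAssignment n m) : Finset (Fin m) := f.graph.image Prod.snd

variable {E : Type*} [MetricSpace E] [MeasurableSpace E] {Δ : ℝ}

/-- Total cost of the matched pairs. -/
noncomputable def substitutionCost (α : ℝ) {P Q : TVPD E Δ} (f : PartialAssignment P.N Q.N) : ℝ :=
  ∑ x ∈ f.graph, (P.sub x.1).D α (Q.sub x.2)

/-- Total distance to `A` of the unmatched subdivisions of `P`. -/
noncomputable def deletionCost (α : ℝ) (A : Set E) {P Q : TVPD E Δ}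
    (f : PartialAssignment P.N Q.N) : ℝ :=
  ∑ i ∈ Finset.univ \ f.dom, (P.sub i).DSet α A

/-- Total distance to `A` of the unmatched subdivisions of `Q`. -/
noncomputable def insertionCost (α : ℝ) (A : Set E) {P Q : TVPD E Δ}
    (f : PartialAssignment P.N Q.N) : ℝ :=
  ∑ j ∈ Finset.univ \ f.im, (Q.sub j).DSet α A

/-- The cost of a partial assignment, with penalty `β` for unmatched subdivisions. -/
noncomputable def cost (α β : ℝ) (A : Set E) {P Q : TVPD E Δ}
    (f : PartialAssignment P.N Q.N) : ℝ :=
  f.substitutionCost α + β * f.deletionCost α A + β * f.insertionCost α A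

end PartialAssignment

/-- The continuous edit distance: the minimal cost of a partial assignment. There are finitely
many of them (at least the empty one), so the infimum is a minimum. -/
noncomputable def CED {E : Type*} [MetricSpace E] [MeasurableSpace E] {Δ : ℝ} (α β : ℝ)
    (A : Set E) (P Q : TVPD E Δ) : ℝ :=
  ⨅ f : PartialAssignment P.N Q.N, f.cost α β A

/-! ### The edit distance is a pseudometric -/

namespace Subdivision

variable {E : Type*} [MetricSpace E] [MeasurableSpace E] {Δ : ℝ}

theorem integral_shift (a : ℝ) (F : ℝ → ℝ) :
    ∫ t in Ioo a (a + Δ), F t = ∫ u in Ioo 0 Δ, F (a + u) := by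
  have h := (measurePreserving_add_left (volume : Measure ℝ) a).setIntegral_preimage_emb
    (measurableEmbedding_addLeft a) F (Ioo a (a + Δ))
  rw [← h]
  congr 2
  ext u
  simp

/-- The map `u ↦ ρ(start + u)` on `(0, Δ)`. -/
def shifted (ρ : Subdivision E Δ) (u : ℝ) : E := ρ.toFun (ρ.start + u)

theorem D_eq (α : ℝ) (ρ q : Subdivision E Δ) :
    ρ.D α q = ∫ u in Ioo 0 Δ,
      ((1 - α) * dist (ρ.shifted u) (q.shifted u) + α * |q.start - ρ.start|) := by
  unfold D shifted
  rw [integral_shift]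
  congr 1
  ext u
  congr 4
  ring

theorem DSet_eq (α : ℝ) (A : Set E) (ρ : Subdivision E Δ) :
    ρ.DSet α A = ∫ u in Ioo 0 Δ, (1 - α) * Metric.infDist (ρ.shifted u) A := by
  unfold DSet shifted
  rw [integral_shift]

theorem isBounded_shifted (ρ : Subdivision E Δ) :
    Bornology.IsBounded (ρ.shifted '' Ioo 0 Δ) := by
  refine ρ.bounded_toFun.subset ?_
  rintro _ ⟨u, hu, rfl⟩
  exact ⟨ρ.start + u, ⟨by linarith [hu.1], by linarith [hu.2]⟩, rfl⟩

theorem D_self (α : ℝ) (ρ : Subdivision E Δ) : ρ.D α ρ = 0 := by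
  rw [D_eq]; simp

theorem D_comm (α : ℝ) (ρ q : Subdivision E Δ) : ρ.D α q = q.D α ρ := by
  rw [D_eq, D_eq]
  simp only [dist_comm (ρ.shifted _), abs_sub_comm q.start]

theorem D_nonneg {α : ℝ} (hα : α ∈ Ioo (0 : ℝ) 1) (ρ q : Subdivision E Δ) : 0 ≤ ρ.D α q := by
  have h0 := hα.1.le
  have h1 : 0 ≤ 1 - α := by linarith [hα.2]
  rw [D_eq]
  exact integral_nonneg fun u => by positivity

theorem DSet_nonneg {α : ℝ} (hα : α ∈ Ioo (0 : ℝ) 1) (A : Set E) (ρ : Subdivision E Δ) :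
    0 ≤ ρ.DSet α A := by
  have h1 : 0 ≤ 1 - α := by linarith [hα.2]
  rw [DSet_eq]
  exact integral_nonneg fun u => mul_nonneg h1 Metric.infDist_nonneg

variable [BorelSpace E] [SecondCountableTopology E]

theorem aemeasurable_shifted (ρ : Subdivision E Δ) :
    AEMeasurable ρ.shifted (volume.restrict (Ioo 0 Δ)) := by
  rcases isEmpty_or_nonempty E with hE | hE
  · exact (hE.false (ρ.toFun 0)).elim
  have h1 : AEMeasurable ρ.toFun (volume.restrict (Ioo ρ.start (ρ.start + Δ))) :=
    ρ.measurable_toFun.aemeasurable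
  have h2 : MeasurePreserving (fun u : ℝ => ρ.start + u)
      (volume.restrict (Ioo 0 Δ)) (volume.restrict (Ioo ρ.start (ρ.start + Δ))) := by
    have h := (measurePreserving_add_left (volume : Measure ℝ) ρ.start).restrict_preimage
      (s := Ioo ρ.start (ρ.start + Δ)) measurableSet_Ioo
    have e : (fun u : ℝ => ρ.start + u) ⁻¹' Ioo ρ.start (ρ.start + Δ) = Ioo 0 Δ := by
      ext u; simp
    rwa [e] at h
  exact AEMeasurable.comp_quasiMeasurePreserving (g := ρ.toFun) h1 h2.quasiMeasurePreserving

theorem integrableOn_of_bound {F : ℝ → ℝ} (hF : AEMeasurable F (volume.restrict (Ioo 0 Δ)))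
    (C : ℝ) (hC : ∀ u ∈ Ioo 0 Δ, |F u| ≤ C) : IntegrableOn F (Ioo 0 Δ) := by
  refine Integrable.of_bound hF.aestronglyMeasurable C ?_
  rw [ae_restrict_iff' measurableSet_Ioo]
  exact Filter.Eventually.of_forall fun u hu => by simpa using hC u hu

theorem integrableOn_dist (ρ q : Subdivision E Δ) :
    IntegrableOn (fun u => dist (ρ.shifted u) (q.shifted u)) (Ioo 0 Δ) := by
  obtain ⟨C, hC⟩ := Metric.isBounded_iff.1 (ρ.isBounded_shifted.union q.isBounded_shifted)
  refine integrableOn_of_bound (ρ.aemeasurable_shifted.dist q.aemeasurable_shifted) C ?_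
  intro u hu
  rw [abs_of_nonneg dist_nonneg]
  exact hC (Or.inl ⟨u, hu, rfl⟩) (Or.inr ⟨u, hu, rfl⟩)

theorem integrableOn_infDist (A : Set E) (ρ : Subdivision E Δ) :
    IntegrableOn (fun u => Metric.infDist (ρ.shifted u) A) (Ioo 0 Δ) := by
  obtain ⟨C, hC⟩ := Metric.isBounded_iff.1 ρ.isBounded_shifted
  refine integrableOn_of_bound
    ((Metric.continuous_infDist_pt A).measurable.comp_aemeasurable ρ.aemeasurable_shifted)
    (Metric.infDist (ρ.shifted (Δ / 2)) A + C) ?_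
  intro u hu
  have hΔ : 0 < Δ := hu.1.trans hu.2
  rw [abs_of_nonneg Metric.infDist_nonneg]
  refine Metric.infDist_le_infDist_add_dist.trans (add_le_add le_rfl ?_)
  exact hC ⟨u, hu, rfl⟩ ⟨Δ / 2, ⟨by linarith, by linarith⟩, rfl⟩

theorem integrableOn_integrand (α : ℝ) (ρ q : Subdivision E Δ) :
    IntegrableOn (fun u => (1 - α) * dist (ρ.shifted u) (q.shifted u) + α * |q.start - ρ.start|)
      (Ioo 0 Δ) :=
  ((ρ.integrableOn_dist q).const_mul _).add (integrableOn_const (by simp))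

theorem D_triangle {α : ℝ} (hα : α ∈ Ioo (0 : ℝ) 1) (ρ q r : Subdivision E Δ) :
    ρ.D α r ≤ ρ.D α q + q.D α r := by
  have h1 : 0 ≤ 1 - α := by linarith [hα.2]
  rw [D_eq, D_eq, D_eq,
    ← integral_add (ρ.integrableOn_integrand α q) (q.integrableOn_integrand α r)]
  refine integral_mono (ρ.integrableOn_integrand α r)
    ((ρ.integrableOn_integrand α q).add (q.integrableOn_integrand α r)) fun u => ?_
  have e1 := mul_le_mul_of_nonneg_left
    (dist_triangle (ρ.shifted u) (q.shifted u) (r.shifted u)) h1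
  have e2 := mul_le_mul_of_nonneg_left (abs_sub_le r.start q.start ρ.start) hα.1.le
  simp only
  linarith

theorem DSet_le {α : ℝ} (hα : α ∈ Ioo (0 : ℝ) 1) (A : Set E) (ρ q : Subdivision E Δ) :
    ρ.DSet α A ≤ ρ.D α q + q.DSet α A := by
  have h1 : 0 ≤ 1 - α := by linarith [hα.2]
  have i1 := (ρ.integrableOn_infDist A).const_mul (1 - α)
  have i2 := (q.integrableOn_infDist A).const_mul (1 - α)
  rw [D_eq, DSet_eq, DSet_eq, ← integral_add (ρ.integrableOn_integrand α q) i2]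
  refine integral_mono i1 ((ρ.integrableOn_integrand α q).add i2) fun u => ?_
  have e1 := mul_le_mul_of_nonneg_left
    (Metric.infDist_le_infDist_add_dist (s := A) (x := ρ.shifted u) (y := q.shifted u)) h1
  have e2 := mul_nonneg hα.1.le (abs_nonneg (q.start - ρ.start))
  simp only
  linarith

end Subdivision

namespace PartialAssignment

variable {n m k : ℕ}

instance : Finite (PartialAssignment n m) :=
  Finite.of_injective PartialAssignment.graph fun _ _ h => PartialAssignment.ext h

instance : Nonempty (PartialAssignment n m) := ⟨⟨∅, by simp, by simp⟩⟩

theorem injective (f : PartialAssignment n m) {x y : Fin n × Fin m} (hx : x ∈ f.graph)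
    (hy : y ∈ f.graph) (h : x.2 = y.2) : x.1 = y.1 := by
  rcases lt_trichotomy x.1 y.1 with h1 | h1 | h1
  · exact absurd h (f.strictMono x hx y hy h1).ne
  · exact h1
  · exact absurd h.symm (f.strictMono y hy x hx h1).ne

/-- The identity assignment. -/
def refl (n : ℕ) : PartialAssignment n n where
  graph := Finset.univ.image fun i => (i, i)
  functional := by simp
  strictMono := by simp

/-- The inverse assignment. -/
def symm (f : PartialAssignment n m) : PartialAssignment m n where
  graph := f.graph.image Prod.swap
  functional := by
    simp only [Finset.mem_image]
    rintro _ ⟨x, hx, rfl⟩ _ ⟨y, hy, rfl⟩ h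
    exact f.injective hx hy h
  strictMono := by
    simp only [Finset.mem_image]
    rintro _ ⟨x, hx, rfl⟩ _ ⟨y, hy, rfl⟩ h
    simp only [Prod.fst_swap, Prod.snd_swap] at h ⊢
    rcases lt_trichotomy x.1 y.1 with h1 | h1 | h1
    · exact h1
    · exact absurd (f.functional x hx y hy h1) h.ne
    · exact absurd (f.strictMono y hy x hx h1) h.not_gt

/-- The composable pairs of pairs of two assignments. -/
def triples (f : PartialAssignment n m) (g : PartialAssignment m k) :
    Finset ((Fin n × Fin m) × (Fin m × Fin k)) :=
  (f.graph ×ˢ g.graph).filter fun z => z.1.2 = z.2.1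

theorem mem_triples {f : PartialAssignment n m} {g : PartialAssignment m k}
    {z : (Fin n × Fin m) × (Fin m × Fin k)} :
    z ∈ f.triples g ↔ (z.1 ∈ f.graph ∧ z.2 ∈ g.graph) ∧ z.1.2 = z.2.1 := by
  simp [triples]

/-- The composition of two assignments. -/
def trans (f : PartialAssignment n m) (g : PartialAssignment m k) : PartialAssignment n k where
  graph := (f.triples g).image fun z => (z.1.1, z.2.2)
  functional := by
    simp only [Finset.mem_image, mem_triples]
    rintro _ ⟨x, ⟨⟨hx1, hx2⟩, hx⟩, rfl⟩ _ ⟨y, ⟨⟨hy1, hy2⟩, hy⟩, rfl⟩ h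
    exact g.functional _ hx2 _ hy2 (by rw [← hx, ← hy]; exact f.functional _ hx1 _ hy1 h)
  strictMono := by
    simp only [Finset.mem_image, mem_triples]
    rintro _ ⟨x, ⟨⟨hx1, hx2⟩, hx⟩, rfl⟩ _ ⟨y, ⟨⟨hy1, hy2⟩, hy⟩, rfl⟩ h
    exact g.strictMono _ hx2 _ hy2 (by rw [← hx, ← hy]; exact f.strictMono _ hx1 _ hy1 h)

variable {E : Type*} [MetricSpace E] [MeasurableSpace E] {Δ : ℝ}

theorem cost_nonneg {α β : ℝ} (hα : α ∈ Ioo (0 : ℝ) 1) (hβ : β ∈ Ioc (0 : ℝ) 1) (A : Set E)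
    {P Q : TVPD E Δ} (f : PartialAssignment P.N Q.N) : 0 ≤ f.cost α β A := by
  have h1 : 0 ≤ f.substitutionCost α := Finset.sum_nonneg fun _ _ => Subdivision.D_nonneg hα _ _
  have h2 : 0 ≤ f.deletionCost α A := Finset.sum_nonneg fun _ _ => Subdivision.DSet_nonneg hα _ _
  have h3 : 0 ≤ f.insertionCost α A := Finset.sum_nonneg fun _ _ => Subdivision.DSet_nonneg hα _ _
  have h4 := hβ.1.le
  unfold cost
  positivity

theorem cost_refl (α β : ℝ) (A : Set E) (P : TVPD E Δ) :
    (refl P.N).cost (P := P) (Q := P) α β A = 0 := by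
  have h1 : (refl P.N).dom = Finset.univ := by ext; simp [refl, dom]
  have h2 : (refl P.N).im = Finset.univ := by ext; simp [refl, im]
  have h3 : (refl P.N).substitutionCost (P := P) (Q := P) α = 0 := by
    refine Finset.sum_eq_zero fun x hx => ?_
    simp only [refl, Finset.mem_image, Finset.mem_univ, true_and] at hx
    obtain ⟨i, rfl⟩ := hx
    exact Subdivision.D_self _ _
  simp [cost, deletionCost, insertionCost, h1, h2, h3]

theorem cost_symm (α β : ℝ) (A : Set E) {P Q : TVPD E Δ} (f : PartialAssignment P.N Q.N) :
    f.symm.cost (P := Q) (Q := P) α β A = f.cost α β A := by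
  have h1 : f.symm.dom = f.im := by ext; simp [symm, dom, im]
  have h2 : f.symm.im = f.dom := by ext; simp [symm, dom, im]
  have h3 : f.symm.substitutionCost (P := Q) (Q := P) α = f.substitutionCost α := by
    unfold substitutionCost
    simp only [symm]
    rw [Finset.sum_image Prod.swap_injective.injOn]
    exact Finset.sum_congr rfl fun x _ => Subdivision.D_comm _ _ _
  unfold cost deletionCost insertionCost
  rw [h1, h2, h3]
  ring

variable [BorelSpace E] [SecondCountableTopology E]

theorem deletionCost_trans {α : ℝ} (hα : α ∈ Ioo (0 : ℝ) 1) (A : Set E) {P Q R : TVPD E Δ}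
    (f : PartialAssignment P.N Q.N) (g : PartialAssignment Q.N R.N) :
    (f.trans g).deletionCost (P := P) (Q := R) α A ≤ f.deletionCost α A + g.deletionCost α A +
      ∑ x ∈ f.graph with x.2 ∉ g.dom, (P.sub x.1).D α (Q.sub x.2) := by
  classical
  set F := f.graph.filter fun x => x.2 ∉ g.dom with hF
  have hsub : Finset.univ \ (f.trans g).dom ⊆ (Finset.univ \ f.dom) ∪ F.image Prod.fst := by
    intro i hi
    by_cases h : i ∈ f.dom
    · refine Finset.mem_union_right _ ?_
      obtain ⟨x, hx, rfl⟩ := Finset.mem_image.1 h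
      refine Finset.mem_image.2 ⟨x, Finset.mem_filter.2 ⟨hx, fun hg => ?_⟩, rfl⟩
      obtain ⟨y, hy, hxy⟩ := Finset.mem_image.1 hg
      refine (Finset.mem_sdiff.1 hi).2 (Finset.mem_image.2 ⟨(x.1, y.2), ?_, rfl⟩)
      exact Finset.mem_image.2 ⟨(x, y), mem_triples.2 ⟨⟨hx, hy⟩, hxy.symm⟩, rfl⟩
    · exact Finset.mem_union_left _ (by simp [h])
  have e1 : (f.trans g).deletionCost (P := P) (Q := R) α A ≤
      f.deletionCost α A + ∑ i ∈ F.image Prod.fst, (P.sub i).DSet α A := by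
    refine (Finset.sum_le_sum_of_subset_of_nonneg hsub
      fun _ _ _ => Subdivision.DSet_nonneg hα _ _).trans ?_
    have h := Finset.sum_union_inter (s₁ := Finset.univ \ f.dom) (s₂ := F.image Prod.fst)
      (f := fun i => (P.sub i).DSet α A)
    have h' : 0 ≤ ∑ i ∈ (Finset.univ \ f.dom) ∩ F.image Prod.fst, (P.sub i).DSet α A :=
      Finset.sum_nonneg fun _ _ => Subdivision.DSet_nonneg hα _ _
    unfold deletionCost
    linarith
  have e2 : ∑ i ∈ F.image Prod.fst, (P.sub i).DSet α A = ∑ x ∈ F, (P.sub x.1).DSet α A := by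
    refine Finset.sum_image fun x hx y hy h => ?_
    exact Prod.ext h (f.functional x (Finset.mem_filter.1 hx).1 y (Finset.mem_filter.1 hy).1 h)
  have e3 : ∑ x ∈ F, (P.sub x.1).DSet α A ≤
      ∑ x ∈ F, (P.sub x.1).D α (Q.sub x.2) + ∑ x ∈ F, (Q.sub x.2).DSet α A := by
    rw [← Finset.sum_add_distrib]
    exact Finset.sum_le_sum fun x _ => Subdivision.DSet_le hα A _ _
  have e4 : ∑ x ∈ F, (Q.sub x.2).DSet α A ≤ g.deletionCost α A := by
    have h : ∑ j ∈ F.image Prod.snd, (Q.sub j).DSet α A = ∑ x ∈ F, (Q.sub x.2).DSet α A := by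
      refine Finset.sum_image fun x hx y hy h => ?_
      exact Prod.ext (f.injective (Finset.mem_filter.1 hx).1 (Finset.mem_filter.1 hy).1 h) h
    rw [← h]
    refine Finset.sum_le_sum_of_subset_of_nonneg ?_ fun _ _ _ => Subdivision.DSet_nonneg hα _ _
    intro j hj
    obtain ⟨x, hx, rfl⟩ := Finset.mem_image.1 hj
    simpa using (Finset.mem_filter.1 hx).2
  linarith

theorem insertionCost_trans {α : ℝ} (hα : α ∈ Ioo (0 : ℝ) 1) (A : Set E) {P Q R : TVPD E Δ}
    (f : PartialAssignment P.N Q.N) (g : PartialAssignment Q.N R.N) :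
    (f.trans g).insertionCost (P := P) (Q := R) α A ≤ f.insertionCost α A + g.insertionCost α A +
      ∑ y ∈ g.graph with y.1 ∉ f.im, (Q.sub y.1).D α (R.sub y.2) := by
  classical
  set F := g.graph.filter fun y => y.1 ∉ f.im with hF
  have hsub : Finset.univ \ (f.trans g).im ⊆ (Finset.univ \ g.im) ∪ F.image Prod.snd := by
    intro i hi
    by_cases h : i ∈ g.im
    · refine Finset.mem_union_right _ ?_
      obtain ⟨y, hy, rfl⟩ := Finset.mem_image.1 h
      refine Finset.mem_image.2 ⟨y, Finset.mem_filter.2 ⟨hy, fun hg => ?_⟩, rfl⟩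
      obtain ⟨x, hx, hxy⟩ := Finset.mem_image.1 hg
      refine (Finset.mem_sdiff.1 hi).2 (Finset.mem_image.2 ⟨(x.1, y.2), ?_, rfl⟩)
      exact Finset.mem_image.2 ⟨(x, y), mem_triples.2 ⟨⟨hx, hy⟩, hxy⟩, rfl⟩
    · exact Finset.mem_union_left _ (by simp [h])
  have e1 : (f.trans g).insertionCost (P := P) (Q := R) α A ≤
      g.insertionCost α A + ∑ i ∈ F.image Prod.snd, (R.sub i).DSet α A := by
    refine (Finset.sum_le_sum_of_subset_of_nonneg hsub
      fun _ _ _ => Subdivision.DSet_nonneg hα _ _).trans ?_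
    have h := Finset.sum_union_inter (s₁ := Finset.univ \ g.im) (s₂ := F.image Prod.snd)
      (f := fun i => (R.sub i).DSet α A)
    have h' : 0 ≤ ∑ i ∈ (Finset.univ \ g.im) ∩ F.image Prod.snd, (R.sub i).DSet α A :=
      Finset.sum_nonneg fun _ _ => Subdivision.DSet_nonneg hα _ _
    unfold insertionCost
    linarith
  have e2 : ∑ i ∈ F.image Prod.snd, (R.sub i).DSet α A = ∑ y ∈ F, (R.sub y.2).DSet α A := by
    refine Finset.sum_image fun x hx y hy h => ?_
    exact Prod.ext (g.injective (Finset.mem_filter.1 hx).1 (Finset.mem_filter.1 hy).1 h) h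
  have e3 : ∑ y ∈ F, (R.sub y.2).DSet α A ≤
      ∑ y ∈ F, (Q.sub y.1).D α (R.sub y.2) + ∑ y ∈ F, (Q.sub y.1).DSet α A := by
    rw [← Finset.sum_add_distrib]
    refine Finset.sum_le_sum fun y _ => ?_
    rw [Subdivision.D_comm]
    exact Subdivision.DSet_le hα A _ _
  have e4 : ∑ y ∈ F, (Q.sub y.1).DSet α A ≤ f.insertionCost α A := by
    have h : ∑ j ∈ F.image Prod.fst, (Q.sub j).DSet α A = ∑ y ∈ F, (Q.sub y.1).DSet α A := by
      refine Finset.sum_image fun x hx y hy h => ?_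
      exact Prod.ext h (g.functional x (Finset.mem_filter.1 hx).1 y (Finset.mem_filter.1 hy).1 h)
    rw [← h]
    refine Finset.sum_le_sum_of_subset_of_nonneg ?_ fun _ _ _ => Subdivision.DSet_nonneg hα _ _
    intro j hj
    obtain ⟨x, hx, rfl⟩ := Finset.mem_image.1 hj
    simpa using (Finset.mem_filter.1 hx).2
  linarith

theorem substitutionCost_trans {α : ℝ} (hα : α ∈ Ioo (0 : ℝ) 1) {P Q R : TVPD E Δ}
    (f : PartialAssignment P.N Q.N) (g : PartialAssignment Q.N R.N) :
    (f.trans g).substitutionCost (P := P) (Q := R) α ≤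
      ∑ x ∈ f.graph with x.2 ∈ g.dom, (P.sub x.1).D α (Q.sub x.2) +
      ∑ y ∈ g.graph with y.1 ∈ f.im, (Q.sub y.1).D α (R.sub y.2) := by
  classical
  have e0 : (f.trans g).substitutionCost (P := P) (Q := R) α =
      ∑ z ∈ f.triples g, (P.sub z.1.1).D α (R.sub z.2.2) := by
    refine Finset.sum_image fun x hx y hy h => ?_
    obtain ⟨⟨hx1, hx2⟩, hx⟩ := mem_triples.1 hx
    obtain ⟨⟨hy1, hy2⟩, hy⟩ := mem_triples.1 hy
    obtain ⟨h1, h2⟩ := Prod.mk.inj h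
    exact Prod.ext (Prod.ext h1 (f.functional _ hx1 _ hy1 h1))
      (Prod.ext (g.injective hx2 hy2 h2) h2)
  have e1 : ∑ z ∈ f.triples g, (P.sub z.1.1).D α (R.sub z.2.2) ≤
      ∑ z ∈ f.triples g, (P.sub z.1.1).D α (Q.sub z.1.2) +
      ∑ z ∈ f.triples g, (Q.sub z.2.1).D α (R.sub z.2.2) := by
    rw [← Finset.sum_add_distrib]
    refine Finset.sum_le_sum fun z hz => ?_
    rw [(mem_triples.1 hz).2]
    exact Subdivision.D_triangle hα _ _ _
  have e2 : ∑ z ∈ f.triples g, (P.sub z.1.1).D α (Q.sub z.1.2) ≤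
      ∑ x ∈ f.graph with x.2 ∈ g.dom, (P.sub x.1).D α (Q.sub x.2) := by
    have h : ∑ x ∈ (f.triples g).image Prod.fst, (P.sub x.1).D α (Q.sub x.2) =
        ∑ z ∈ f.triples g, (P.sub z.1.1).D α (Q.sub z.1.2) := by
      refine Finset.sum_image fun x hx y hy h => ?_
      obtain ⟨⟨hx1, hx2⟩, hx⟩ := mem_triples.1 hx
      obtain ⟨⟨hy1, hy2⟩, hy⟩ := mem_triples.1 hy
      have h1 : x.2.1 = y.2.1 := by rw [← hx, ← hy, h]
      exact Prod.ext h (Prod.ext h1 (g.functional _ hx2 _ hy2 h1))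
    rw [← h]
    refine Finset.sum_le_sum_of_subset_of_nonneg ?_ fun _ _ _ => Subdivision.D_nonneg hα _ _
    intro x hx
    obtain ⟨z, hz, rfl⟩ := Finset.mem_image.1 hx
    obtain ⟨⟨hz1, hz2⟩, hz⟩ := mem_triples.1 hz
    exact Finset.mem_filter.2 ⟨hz1, Finset.mem_image.2 ⟨z.2, hz2, hz.symm⟩⟩
  have e3 : ∑ z ∈ f.triples g, (Q.sub z.2.1).D α (R.sub z.2.2) ≤
      ∑ y ∈ g.graph with y.1 ∈ f.im, (Q.sub y.1).D α (R.sub y.2) := by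
    have h : ∑ x ∈ (f.triples g).image Prod.snd, (Q.sub x.1).D α (R.sub x.2) =
        ∑ z ∈ f.triples g, (Q.sub z.2.1).D α (R.sub z.2.2) := by
      refine Finset.sum_image fun x hx y hy h => ?_
      obtain ⟨⟨hx1, hx2⟩, hx⟩ := mem_triples.1 hx
      obtain ⟨⟨hy1, hy2⟩, hy⟩ := mem_triples.1 hy
      have h1 : x.1.2 = y.1.2 := by rw [hx, hy, h]
      exact Prod.ext (Prod.ext (f.injective hx1 hy1 h1) h1) h
    rw [← h]
    refine Finset.sum_le_sum_of_subset_of_nonneg ?_ fun _ _ _ => Subdivision.D_nonneg hα _ _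
    intro x hx
    obtain ⟨z, hz, rfl⟩ := Finset.mem_image.1 hx
    obtain ⟨⟨hz1, hz2⟩, hz⟩ := mem_triples.1 hz
    exact Finset.mem_filter.2 ⟨hz2, Finset.mem_image.2 ⟨z.1, hz1, hz⟩⟩
  linarith

theorem cost_trans {α β : ℝ} (hα : α ∈ Ioo (0 : ℝ) 1) (hβ : β ∈ Ioc (0 : ℝ) 1) (A : Set E)
    {P Q R : TVPD E Δ} (f : PartialAssignment P.N Q.N) (g : PartialAssignment Q.N R.N) :
    (f.trans g).cost (P := P) (Q := R) α β A ≤ f.cost α β A + g.cost α β A := by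
  have h1 := f.substitutionCost_trans hα g
  have h2 := mul_le_mul_of_nonneg_left (f.deletionCost_trans hα A g) hβ.1.le
  have h3 := mul_le_mul_of_nonneg_left (f.insertionCost_trans hα A g) hβ.1.le
  have s1 := Finset.sum_filter_add_sum_filter_not f.graph (fun x => x.2 ∈ g.dom)
    fun x => (P.sub x.1).D α (Q.sub x.2)
  have s2 := Finset.sum_filter_add_sum_filter_not g.graph (fun y => y.1 ∈ f.im)
    fun y => (Q.sub y.1).D α (R.sub y.2)
  have n1 : 0 ≤ ∑ x ∈ f.graph with x.2 ∉ g.dom, (P.sub x.1).D α (Q.sub x.2) :=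
    Finset.sum_nonneg fun _ _ => Subdivision.D_nonneg hα _ _
  have n2 : 0 ≤ ∑ y ∈ g.graph with y.1 ∉ f.im, (Q.sub y.1).D α (R.sub y.2) :=
    Finset.sum_nonneg fun _ _ => Subdivision.D_nonneg hα _ _
  have m1 := mul_le_mul_of_nonneg_right hβ.2 n1
  have m2 := mul_le_mul_of_nonneg_right hβ.2 n2
  unfold cost
  unfold substitutionCost at *
  linarith

end PartialAssignment

theorem CED_le {E : Type*} [MetricSpace E] [MeasurableSpace E] {Δ : ℝ} (α β : ℝ)
    (A : Set E) {P Q : TVPD E Δ} (f : PartialAssignment P.N Q.N) :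
    CED α β A P Q ≤ f.cost α β A :=
  ciInf_le (Set.finite_range _).bddBelow f

/-- The minimum defining the edit distance is attained. -/
theorem exists_cost_eq_CED {E : Type*} [MetricSpace E] [MeasurableSpace E] {Δ : ℝ} (α β : ℝ)
    (A : Set E) (P Q : TVPD E Δ) :
    ∃ f : PartialAssignment P.N Q.N, f.cost α β A = CED α β A P Q :=
  exists_eq_ciInf_of_finite

/-- For `α ∈ (0,1)` and `β ∈ (0,1]` the edit distance is a pseudometric. -/
noncomputable abbrev CED.pseudoMetricSpace {E : Type*} [MetricSpace E] [MeasurableSpace E]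
    [BorelSpace E] [SecondCountableTopology E] (Δ : ℝ) (A : Set E) {α β : ℝ}
    (hα : α ∈ Ioo (0 : ℝ) 1) (hβ : β ∈ Ioc (0 : ℝ) 1) : PseudoMetricSpace (TVPD E Δ) where
  dist := CED α β A
  dist_self P := le_antisymm
    ((CED_le α β A (PartialAssignment.refl P.N)).trans (PartialAssignment.cost_refl α β A P).le)
    (le_ciInf fun f => f.cost_nonneg hα hβ A)
  dist_comm P Q := le_antisymm
    (le_ciInf fun f => (CED_le α β A f.symm).trans (f.cost_symm α β A).le)
    (le_ciInf fun f => (CED_le α β A f.symm).trans (f.cost_symm α β A).le)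
  dist_triangle P Q R := by
    obtain ⟨f, hf⟩ := exists_cost_eq_CED α β A P Q
    obtain ⟨g, hg⟩ := exists_cost_eq_CED α β A Q R
    rw [← hf, ← hg]
    exact (CED_le α β A (f.trans g)).trans (f.cost_trans hα hβ A g)

theorem one_mem_Ioc_zero_one : (1 : ℝ) ∈ Ioc (0 : ℝ) 1 := ⟨one_pos, le_rfl⟩

/-- The space of time-varying diagrams modulo zero edit distance. -/
def TVPDSpace {E : Type*} [MetricSpace E] [MeasurableSpace E] [BorelSpace E]
    [SecondCountableTopology E] (Δ : ℝ) (A : Set E) {α β : ℝ}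
    (hα : α ∈ Ioo (0 : ℝ) 1) (hβ : β ∈ Ioc (0 : ℝ) 1) : Type _ :=
  @SeparationQuotient (TVPD E Δ) (CED.pseudoMetricSpace Δ A hα hβ).toUniformSpace.toTopologicalSpace

namespace TVPDSpace

variable {E : Type*} [MetricSpace E] [MeasurableSpace E] [BorelSpace E]
  [SecondCountableTopology E] {Δ : ℝ} {A : Set E} {α β : ℝ}
  {hα : α ∈ Ioo (0 : ℝ) 1} {hβ : β ∈ Ioc (0 : ℝ) 1}

noncomputable instance : MetricSpace (TVPDSpace Δ A hα hβ) :=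
  @SeparationQuotient.instMetricSpace (TVPD E Δ) (CED.pseudoMetricSpace Δ A hα hβ)

/-- The class of a time-varying diagram. -/
noncomputable def mk (P : TVPD E Δ) : TVPDSpace Δ A hα hβ :=
  letI := CED.pseudoMetricSpace Δ A hα hβ
  SeparationQuotient.mk P

theorem mk_surjective : Function.Surjective (mk : TVPD E Δ → TVPDSpace Δ A hα hβ) :=
  letI := CED.pseudoMetricSpace Δ A hα hβ
  SeparationQuotient.surjective_mk

theorem dist_mk (P Q : TVPD E Δ) :
    dist (mk P : TVPDSpace Δ A hα hβ) (mk Q) = CED α β A P Q := rfl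

theorem mk_eq_mk_iff (P Q : TVPD E Δ) :
    (mk P : TVPDSpace Δ A hα hβ) = mk Q ↔ CED α β A P Q = 0 := by
  rw [← dist_eq_zero, dist_mk]

end TVPDSpace

/-! ### The three-stage path of a partial assignment -/

/-- A constant-speed geodesic `g : [0,1] → (subdivisions, D^α_Δ)` from `ρ` to `q`, which moves the
interval linearly and moves almost every value along a constant-speed geodesic of `E`. -/
structure Subdivision.IsGeodesicPath {E : Type*} [MetricSpace E] [MeasurableSpace E] {Δ : ℝ}
    (α : ℝ) (g : ℝ → Subdivision E Δ) (ρ q : Subdivision E Δ) : Prop where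
  source : g 0 = ρ
  target : g 1 = q
  speed : ∀ s ∈ Icc (0 : ℝ) 1, ∀ T ∈ Icc (0 : ℝ) 1, (g s).D α (g T) = |s - T| * ρ.D α q
  start_eq : ∀ T ∈ Icc (0 : ℝ) 1, (g T).start = (1 - T) * ρ.start + T * q.start
  pointwise : ∀ᵐ u ∂(volume.restrict (Ioo 0 Δ)),
    ∀ s ∈ Icc (0 : ℝ) 1, ∀ T ∈ Icc (0 : ℝ) 1,
      dist ((g s).toFun ((g s).start + u)) ((g T).toFun ((g T).start + u)) =
        |s - T| * dist (ρ.toFun (ρ.start + u)) (q.toFun (q.start + u))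

/-- `p` is a nearest-point projection of `ρ` to `A`: it lives on the same interval and almost all
its values are points of `A` nearest to the corresponding values of `ρ`. -/
def Subdivision.IsProjection {E : Type*} [MetricSpace E] [MeasurableSpace E] {Δ : ℝ}
    (A : Set E) (ρ p : Subdivision E Δ) : Prop :=
  p.start = ρ.start ∧ ∀ᵐ t ∂(volume.restrict (Ioo ρ.start (ρ.start + Δ))),
    p.toFun t ∈ A ∧ dist (ρ.toFun t) (p.toFun t) = Metric.infDist (ρ.toFun t) A

/-- The subdivisions of `R` are, from left to right, the `h i` for `i` in the finite set `s` taken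
in increasing order. -/
def TVPD.IsListing {E : Type*} [MetricSpace E] [MeasurableSpace E] {Δ : ℝ} {ι : Type*}
    [Preorder ι] (R : TVPD E Δ) (s : Finset ι) (h : ι → Subdivision E Δ) : Prop :=
  ∃ e : Fin R.N → ι, StrictMono e ∧ Set.range e = (s : Set ι) ∧ ∀ k, R.sub k = h (e k)

/-- The path `γ` follows the delete, substitute, insert scheme of the partial assignment `f` between
`P` and `Q`, with break points `L₁ ≤ L₂ ≤ L₃`: on `[0, L₁]` the unmatched subdivisions of `P` move
to nearest-point projections to `A`, the others being fixed; on `[L₁, L₂]` only the matched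
subdivisions are present, and move to their partners in `Q`; on `[L₂, L₃]` the unmatched
subdivisions of `Q` come out of nearest-point projections to `A`, the matched ones being fixed.
A subdivision with values in `A` has zero cost, so it can be dropped or added at `L₁` and `L₂`
without changing the class. If nothing is matched then `L₁ = L₂` and the second stage is void.
A stage of zero length has parameter `0 / 0 = 0`. -/
def TVPDSpace.IsDeleteSubstituteInsert {E : Type*} [MetricSpace E] [MeasurableSpace E]
    [BorelSpace E] [SecondCountableTopology E] {Δ : ℝ} {A : Set E} {α β : ℝ}
    {hα : α ∈ Ioo (0 : ℝ) 1} {hβ : β ∈ Ioc (0 : ℝ) 1}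
    (P Q : TVPD E Δ) (f : PartialAssignment P.N Q.N) (γ : ℝ → TVPDSpace Δ A hα hβ) : Prop :=
  let L₁ := f.deletionCost α A
  let L₂ := f.deletionCost α A + f.substitutionCost α
  let L₃ := f.deletionCost α A + f.substitutionCost α + f.insertionCost α A
  ∃ (p : Fin P.N → Subdivision E Δ) (q : Fin Q.N → Subdivision E Δ)
    (gDel : Fin P.N → ℝ → Subdivision E Δ)
    (gSub : Fin P.N × Fin Q.N → ℝ → Subdivision E Δ)
    (gIns : Fin Q.N → ℝ → Subdivision E Δ),
    (∀ i ∉ f.dom, (P.sub i).IsProjection A (p i) ∧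
      Subdivision.IsGeodesicPath α (gDel i) (P.sub i) (p i)) ∧
    (∀ x ∈ f.graph, Subdivision.IsGeodesicPath α (gSub x) (P.sub x.1) (Q.sub x.2)) ∧
    (∀ j ∉ f.im, (Q.sub j).IsProjection A (q j) ∧
      Subdivision.IsGeodesicPath α (gIns j) (q j) (Q.sub j)) ∧
    (∀ l ∈ Icc 0 L₁, ∃ R : TVPD E Δ, γ l = mk R ∧
      R.IsListing Finset.univ fun i => if i ∈ f.dom then P.sub i else gDel i (l / L₁)) ∧
    (f.graph.Nonempty → ∀ l ∈ Icc L₁ L₂, ∃ R : TVPD E Δ, γ l = mk R ∧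
      R.IsListing f.graph fun x => gSub x ((l - L₁) / (L₂ - L₁))) ∧
    (∀ l ∈ Icc L₂ L₃, ∃ R : TVPD E Δ, γ l = mk R ∧
      R.IsListing Finset.univ fun j =>
        if j ∈ f.im then Q.sub j else gIns j ((l - L₂) / (L₃ - L₂)))

/-! Once an optimal assignment `f` is fixed, only upper bounds on distances are needed. The edit
distance is a minimum over assignments, so matching each moving subdivision with its own later
position shows that a diagram moves at most at the total speed of its subdivisions
(`exists_path_of_sum_D_le`). Moving an unmatched subdivision to a nearest-point projection on the
same interval costs exactly its distance to `A`, and moving a matched one to its partner costs their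
distance. The three stages together therefore have length at most the cost of `f`, which by
optimality is the distance between the end points. A 1-Lipschitz path on an interval as long as the
distance between its ends is a geodesic (`isGeodesic_of_dist_le`).

The stages fit together in the quotient because a subdivision almost all of whose values lie in `A`
can be dropped or added at zero cost (`mk_eq_mk_of_drop`). The interpolated diagrams remain ordered
because disjointness of successive intervals is an affine inequality between left end points.

The analytic content is that nearest points and geodesics of `E` can be chosen measurably in the
time parameter. Both choices are sections of a continuous surjection from a Polish space: the set of
constant-speed paths over pairs of end points, and the closed relation "is a nearest point of `A`"
over `E`. `exists_aemeasurable_section` provides such sections: the Polish space is a continuous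
image of the Baire space, the leftmost branch of each fibre is measurable with respect to images of
cylinders, and these images are analytic, hence measurable for the completion of any finite Borel
measure. -/

/-! ### Measurable selection -/

section Selection

open Filter Topology

/-- An open set containing a product of initial segments of `ℕ` contains a cylinder over
finitely many of them. -/
theorem exists_forall_lt_le_subset_of_isOpen (n : ℕ → ℕ) {W : Set (ℕ → ℕ)} (hW : IsOpen W)
    (h : Set.pi univ (fun i => Iic (n i)) ⊆ W) : ∃ k, {x : ℕ → ℕ | ∀ i < k, x i ≤ n i} ⊆ W := by
  by_contra! hcon
  simp only [Set.not_subset] at hcon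
  choose x hx hxW using hcon
  have hK : IsCompact (Set.pi univ (fun i => Iic (n i))) :=
    isCompact_univ_pi fun i => (finite_Iic (n i)).isCompact
  -- Truncating at `n` puts the points into a compact product, and coordinate `i` of the `k`-th
  -- point is unaffected as soon as `k > i`, so the untruncated subsequence has the same limit.
  obtain ⟨a, ha, φ, hφ, hlim⟩ := hK.tendsto_subseq (x := fun k i => min (x k i) (n i))
    (fun k => mem_univ_pi.2 fun i => mem_Iic.2 (min_le_right _ _))
  have hlim' : Tendsto (fun k => x (φ k)) atTop (𝓝 a) := by
    rw [tendsto_pi_nhds] at hlim ⊢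
    intro i
    refine (hlim i).congr' ?_
    filter_upwards [eventually_gt_atTop i] with k hk
    exact min_eq_left (hx (φ k) i (hk.trans_le (hφ.id_le k)))
  exact hW.isClosed_compl.mem_of_tendsto hlim' (Eventually.of_forall fun k => hxW _) (h ha)

/-- Choquet's capacitability argument: bound the coordinates one after the other, keeping the outer
measure of the image above `c`. The bounds cut out a compact subset of the Baire space, whose image
is compact and still has measure at least `c`. -/
theorem exists_measurableSet_subset_range {X : Type*} [TopologicalSpace X] [T2Space X]
    [MeasurableSpace X] [OpensMeasurableSpace X] (ν : Measure X) [IsFiniteMeasure ν]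
    {f : (ℕ → ℕ) → X} (hf : Continuous f) {c : ENNReal} (hc : c < ν (range f)) :
    ∃ t ⊆ range f, MeasurableSet t ∧ c ≤ ν t := by
  have step : ∀ (k : ℕ) (S : Set (ℕ → ℕ)), c < ν (f '' S) →
      ∃ m, c < ν (f '' (S ∩ {x | x k ≤ m})) := by
    intro k S hS
    have e : f '' S = ⋃ m, f '' (S ∩ {x | x k ≤ m}) := by
      rw [← image_iUnion, ← inter_iUnion]
      congr 1
      exact (inter_eq_left.2 fun x _ => mem_iUnion.2 ⟨x k, by simp⟩).symm
    have hmono : Monotone fun m => f '' (S ∩ {x | x k ≤ m}) := fun a b hab =>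
      image_mono fun x hx => ⟨hx.1, le_trans hx.2 hab⟩
    -- These images need not be measurable, but continuity along increasing unions holds for
    -- arbitrary sets.
    rw [e, hmono.measure_iUnion] at hS
    exact lt_iSup_iff.1 hS
  choose m hm using step
  let T : ℕ → {S : Set (ℕ → ℕ) // c < ν (f '' S)} := Nat.rec ⟨univ, by rwa [image_univ]⟩
    fun k S => ⟨S.1 ∩ {x | x k ≤ m k S.1 S.2}, hm k S.1 S.2⟩
  let n : ℕ → ℕ := fun k => m k (T k).1 (T k).2
  have hT : ∀ k, (T k).1 = {x | ∀ i < k, x i ≤ n i} := by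
    intro k
    induction k with
    | zero => ext; simp [T]
    | succ k ih =>
      have : (T (k + 1)).1 = (T k).1 ∩ {x | x k ≤ n k} := rfl
      rw [this, ih]
      ext x
      simp only [mem_inter_iff, mem_ofPred_eq, Nat.lt_succ_iff_lt_or_eq, or_imp, forall_and,
        forall_eq]
  set K : Set (ℕ → ℕ) := Set.pi univ (fun i => Iic (n i))
  have hK : IsCompact K := isCompact_univ_pi fun i => (finite_Iic (n i)).isCompact
  have hfK : IsCompact (f '' K) := hK.image hf
  refine ⟨f '' K, image_subset_range _ _, hfK.isClosed.measurableSet, ?_⟩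
  -- A point off the compact image has a neighbourhood `V` disjoint from an open `U` around that
  -- image. The preimage of `U` already contains some cylinder `T k`, so the closure of its image
  -- misses the point.
  have hsub : ⋂ k, closure (f '' (T k).1) ⊆ f '' K := by
    intro y hy
    by_contra hyK
    obtain ⟨U, V, hU, hV, hKU, hyV, hUV⟩ := hfK.separation_of_notMem hyK
    obtain ⟨k, hk⟩ := exists_forall_lt_le_subset_of_isOpen n (hU.preimage hf)
      (image_subset_iff.1 hKU)
    have h1 : f '' (T k).1 ⊆ Vᶜ := by
      rw [hT k]
      exact (image_subset_iff.2 hk).trans hUV.subset_compl_right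
    exact closure_minimal h1 hV.isClosed_compl (mem_iInter.1 hy k) hyV
  have hanti : Antitone fun k => closure (f '' (T k).1) := by
    refine antitone_nat_of_succ_le fun k => closure_mono (image_mono ?_)
    exact inter_subset_left
  refine le_trans ?_ (measure_mono hsub)
  -- Passing to closures makes the sets measurable, as continuity along decreasing intersections
  -- requires.
  rw [hanti.measure_iInter (fun k => isClosed_closure.measurableSet.nullMeasurableSet)
    ⟨0, measure_ne_top _ _⟩]
  exact le_iInf fun k => (T k).2.le.trans (measure_mono subset_closure)

/-- Analytic sets are measurable for the completion of every finite Borel measure. -/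
theorem MeasureTheory.AnalyticSet.nullMeasurableSet {X : Type*} [TopologicalSpace X] [T2Space X]
    [MeasurableSpace X] [OpensMeasurableSpace X] {s : Set X} (hs : AnalyticSet s)
    (ν : Measure X) [IsFiniteMeasure ν] : NullMeasurableSet s ν := by
  rw [AnalyticSet] at hs
  rcases hs with rfl | ⟨f, hf, rfl⟩
  · exact nullMeasurableSet_empty
  by_cases h0 : ν (range f) = 0
  · exact NullMeasurableSet.of_null h0
  -- Measurable subsets with measure within `1 / (k + 1)` of the outer measure have a union of full
  -- outer measure. Finiteness then makes that union almost equal to the range.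
  have hlt : ∀ k : ℕ, ν (range f) - ((k : ENNReal) + 1)⁻¹ < ν (range f) := fun k =>
    ENNReal.sub_lt_self (measure_ne_top _ _) h0 (by simp)
  choose t hts htm ht using fun k => exists_measurableSet_subset_range ν hf (hlt k)
  have hU : MeasurableSet (⋃ k, t k) := MeasurableSet.iUnion htm
  have hge : ν (range f) ≤ ν (⋃ k, t k) := by
    refine ENNReal.le_of_forall_pos_le_add fun ε hε _ => ?_
    obtain ⟨k, hk⟩ := ENNReal.exists_inv_nat_lt (a := (ε : ENNReal)) (by simpa using hε.ne')
    have h1 : ((k : ENNReal) + 1)⁻¹ ≤ ε := by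
      refine le_trans (ENNReal.inv_le_inv.2 ?_) hk.le
      exact le_self_add
    have h2 := (ht k).trans (measure_mono (subset_iUnion t k))
    exact (tsub_le_iff_right.1 h2).trans (by gcongr)
  exact NullMeasurableSet.congr hU.nullMeasurableSet
    (ae_eq_of_subset_of_measure_ge (iUnion_subset hts) hge hU.nullMeasurableSet
      (measure_ne_top _ _))

/-- The sequences starting with a given list. -/
def sequencesExtending (l : List ℕ) : Set (ℕ → ℕ) := {z | (List.range l.length).map z = l}

theorem isClosed_sequencesExtending (l : List ℕ) : IsClosed (sequencesExtending l) := by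
  have e : sequencesExtending l = ⋂ (i : ℕ) (h : i < l.length), {z | z i = l[i]} := by
    ext z
    simp only [sequencesExtending, mem_ofPred_eq, mem_iInter]
    refine ⟨fun h i hi => ?_, fun h => List.ext_getElem (by simp) fun i _ h2 => by simpa using h i h2⟩
    conv_rhs => rw [List.getElem_of_eq h.symm hi]
    simp
  rw [e]
  exact isClosed_iInter fun i => isClosed_iInter fun h =>
    isClosed_eq (continuous_apply i) continuous_const

/-- A continuous surjection from the Baire space has a section that is measurable for every
`σ`-algebra containing the images of the basic open sets. -/
theorem exists_measurable_section_of_nat_nat {X : Type*} [TopologicalSpace X] [T2Space X]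
    (mX : MeasurableSpace X) {F : (ℕ → ℕ) → X} (hF : Continuous F)
    (hsurj : Function.Surjective F) (hm : ∀ l, MeasurableSet (F '' sequencesExtending l)) :
    ∃ s : X → ℕ → ℕ, Measurable s ∧ ∀ x, F (s x) = x := by
  classical
  -- The least `n` for which the prefix extended by `n` still begins a preimage of the point gives
  -- the leftmost branch. The second alternative only makes `Nat.find` total; `hmem` shows that it
  -- is never needed along the branch.
  let p : X × List ℕ → ℕ → Prop := fun y n => y.1 ∈ F '' sequencesExtending (y.2 ++ [n]) ∨
    ∀ j, y.1 ∉ F '' sequencesExtending (y.2 ++ [j])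
  have hp : ∀ y, ∃ n, p y n := by
    intro y
    by_cases h : ∃ n, y.1 ∈ F '' sequencesExtending (y.2 ++ [n])
    · exact ⟨h.choose, Or.inl h.choose_spec⟩
    · exact ⟨0, Or.inr (not_exists.1 h)⟩
  let _ : MeasurableSpace (List ℕ) := ⊤
  have : DiscreteMeasurableSpace (List ℕ) := ⟨fun _ => trivial⟩
  have hfind : Measurable fun y => Nat.find (hp y) := by
    refine measurable_from_prod_countable_left fun l => ?_
    refine measurable_find (fun x => hp (x, l)) fun k => ?_
    change MeasurableSet (F '' sequencesExtending (l ++ [k]) ∪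
      {x | ∀ j, x ∉ F '' sequencesExtending (l ++ [j])})
    refine MeasurableSet.union (hm _) ?_
    have e : {x | ∀ j, x ∉ F '' sequencesExtending (l ++ [j])} =
        ⋂ j, (F '' sequencesExtending (l ++ [j]))ᶜ := by
      ext; simp
    exact e ▸ MeasurableSet.iInter fun j => (hm _).compl
  let L : X → ℕ → List ℕ := fun x => Nat.rec [] fun _ l => l ++ [Nat.find (hp (x, l))]
  let s : X → ℕ → ℕ := fun x k => Nat.find (hp (x, L x k))
  have hLs : ∀ x k, L x (k + 1) = L x k ++ [s x k] := fun _ _ => rfl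
  have hLm : ∀ k, Measurable fun x => L x k := by
    intro k
    induction k with
    | zero => exact measurable_const
    | succ k ih =>
      have h1 : Measurable fun x => (L x k, s x k) :=
        ih.prodMk (hfind.comp (measurable_id.prodMk ih))
      exact (measurable_of_countable fun z : List ℕ × ℕ => z.1 ++ [z.2]).comp h1
  have hlen : ∀ x k, (L x k).length = k := by
    intro x k
    induction k with
    | zero => rfl
    | succ k ih => rw [hLs, List.length_append, ih]; rfl
  have hmap : ∀ x k, (List.range k).map (s x) = L x k := by
    intro x k
    induction k with
    | zero => rfl
    | succ k ih => rw [hLs, List.range_succ, List.map_append, ih]; rfl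
  have hmem : ∀ x k, x ∈ F '' sequencesExtending (L x k) := by
    intro x k
    induction k with
    | zero =>
      obtain ⟨z, hz⟩ := hsurj x
      exact ⟨z, rfl, hz⟩
    | succ k ih =>
      rcases Nat.find_spec (hp (x, L x k)) with h | h
      · exact h
      · obtain ⟨z, hz, hzx⟩ := ih
        refine absurd ⟨z, ?_, hzx⟩ (h (z k))
        have hz' : (List.range (L x k).length).map z = L x k := hz
        rw [hlen] at hz'
        simp [sequencesExtending, List.range_succ, hz', hlen]
  refine ⟨s, measurable_pi_lambda _ fun k => hfind.comp (measurable_id.prodMk (hLm k)),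
    fun x => ?_⟩
  -- Preimages `z k` of `x` agreeing with `s x` on the first `k` coordinates converge to `s x`, so
  -- continuity of `F` puts `s x` itself in the fibre.
  choose z hz hzx using hmem x
  have hlim : Tendsto z atTop (𝓝 (s x)) := by
    rw [tendsto_pi_nhds]
    intro i
    refine tendsto_const_nhds.congr' ?_
    filter_upwards [eventually_gt_atTop i] with k hk
    have h1 : (List.range k).map (z k) = (List.range k).map (s x) := by
      rw [hmap]
      have : (List.range (L x k).length).map (z k) = L x k := hz k
      rwa [hlen] at this
    exact (List.map_inj_left.1 h1 i (List.mem_range.2 hk)).symm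
  have h2 := (hF.tendsto (s x)).comp hlim
  have h3 : F ∘ z = fun _ => x := funext hzx
  rw [h3] at h2
  exact tendsto_nhds_unique h2 tendsto_const_nhds

/-- **Jankov–von Neumann selection**: a continuous surjection from a Polish space has a section
that is measurable up to null sets for every finite Borel measure. -/
theorem exists_aemeasurable_section {Z X : Type*} [TopologicalSpace Z] [PolishSpace Z]
    [MeasurableSpace Z] [BorelSpace Z] [TopologicalSpace X] [T2Space X] [MeasurableSpace X]
    [OpensMeasurableSpace X] {π : Z → X} (hπ : Continuous π) (hsurj : Function.Surjective π) :
    ∀ (ν : Measure X) [IsFiniteMeasure ν], ∃ s : X → Z, AEMeasurable s ν ∧ ∀ x, π (s x) = x := by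
  intro ν _
  rcases isEmpty_or_nonempty Z with hZ | hZ
  · have : IsEmpty X := ⟨fun x => hZ.false (hsurj x).choose⟩
    exact ⟨fun x => (this.false x).elim, (measurable_of_empty _).aemeasurable,
      fun x => (this.false x).elim⟩
  obtain ⟨g, hg, hgs⟩ := PolishSpace.exists_nat_nat_continuous_surjective Z
  -- The `σ`-algebra used on `X` is that of the `ν`-null-measurable sets, which contains the
  -- analytic images of the closed cylinders.
  obtain ⟨s, hs, hsec⟩ := exists_measurable_section_of_nat_nat (X := X)
    (NullMeasurableSpace.instMeasurableSpace (α := X) (μ := ν)) (hπ.comp hg) (hsurj.comp hgs)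
    fun l => ((isClosed_sequencesExtending l).analyticSet.image_of_continuous
      (hπ.comp hg)).nullMeasurableSet ν
  have hs' : NullMeasurable s ν := hs
  have : NullMeasurable (g ∘ s) ν := hg.measurable.comp_nullMeasurable hs'
  exact ⟨g ∘ s, this.aemeasurable, hsec⟩

end Selection

/-! ### Constant-speed geodesics -/

section Geodesics

open unitInterval

variable {X : Type*} [MetricSpace X]

/-- The paths on `[0,1]` which are constant-speed geodesics between their end points. -/
def constantSpeedGeodesics (X : Type*) [MetricSpace X] : Set C(I, X) :=
  {c | ∀ s t : I, dist (c s) (c t) = |(s : ℝ) - t| * dist (c 0) (c 1)}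

theorem isClosed_constantSpeedGeodesics : IsClosed (constantSpeedGeodesics X) := by
  have e : constantSpeedGeodesics X =
      ⋂ (s : I) (t : I), {c | dist (c s) (c t) = |(s : ℝ) - t| * dist (c 0) (c 1)} := by
    ext; simp only [constantSpeedGeodesics, mem_ofPred_eq, mem_iInter]
  rw [e]
  exact isClosed_iInter fun s => isClosed_iInter fun t => isClosed_eq (by fun_prop) (by fun_prop)

/-- Length is additive over `[0, s]`, `[s, t]` and `[t, d(x,y)]`, and on each piece bounds the
distance between the ends. -/
theorem IsGeodesic.dist_add_dist_add_dist_le {x y : X} {γ : ℝ → X} (h : IsGeodesic x y γ) {s t : ℝ}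
    (hs : 0 ≤ s) (hst : s ≤ t) (ht : t ≤ dist x y) :
    dist x (γ s) + dist (γ s) (γ t) + dist (γ t) y ≤ dist x y := by
  have h1 := eVariationOn.Icc_add_Icc γ (s := univ) hs hst (mem_univ _)
  have h2 := eVariationOn.Icc_add_Icc γ (s := univ) (hs.trans hst) ht (mem_univ _)
  simp only [univ_inter] at h1 h2
  have e1 := eVariationOn.edist_le γ (left_mem_Icc.2 hs) (right_mem_Icc.2 hs)
  have e2 := eVariationOn.edist_le γ (left_mem_Icc.2 hst) (right_mem_Icc.2 hst)
  have e3 := eVariationOn.edist_le γ (left_mem_Icc.2 ht) (right_mem_Icc.2 ht)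
  rw [h.source] at e1
  rw [h.target] at e3
  have := add_le_add (add_le_add e1 e2) e3
  rw [h1, h2, h.length, edist_dist, edist_dist, edist_dist,
    ← ENNReal.ofReal_add dist_nonneg dist_nonneg,
    ← ENNReal.ofReal_add (by positivity) dist_nonneg] at this
  exact (ENNReal.ofReal_le_ofReal_iff dist_nonneg).1 this

theorem IsGeodesic.dist_eq_sub {x y : X} {γ : ℝ → X} (h : IsGeodesic x y γ) {s t : ℝ}
    (hs : 0 ≤ s) (hst : s ≤ t) (ht : t ≤ dist x y) :
    dist (γ s) (γ t) = dist x (γ t) - dist x (γ s) := by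
  have h1 := h.dist_add_dist_add_dist_le hs hst ht
  have h2 := dist_triangle x (γ t) y
  have h3 := dist_triangle x (γ s) (γ t)
  linarith

theorem IsGeodesic.dist_eq_abs_sub {x y : X} {γ : ℝ → X} (h : IsGeodesic x y γ) {s t : ℝ}
    (hs : s ∈ Icc 0 (dist x y)) (ht : t ∈ Icc 0 (dist x y)) :
    dist (γ s) (γ t) = |dist x (γ s) - dist x (γ t)| := by
  rcases le_total s t with hst | hst
  · have := h.dist_eq_sub hs.1 hst ht.2
    rw [abs_sub_comm, ← this, abs_of_nonneg dist_nonneg]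
  · have := h.dist_eq_sub ht.1 hst hs.2
    rw [← this, dist_comm, abs_of_nonneg dist_nonneg]

/-- A geodesic can be parametrized by arc length. -/
theorem IsGeodesic.exists_mem_constantSpeedGeodesics {x y : X} {γ : ℝ → X}
    (h : IsGeodesic x y γ) : ∃ c ∈ constantSpeedGeodesics X, c 0 = x ∧ c 1 = y := by
  -- The given geodesic may have any parametrization, so times are chosen by the intermediate value
  -- theorem applied to the distance from `x`. The choice `τ` need not be continuous; `γ ∘ τ` is,
  -- since its distances are determined by those from `x`.
  have hmem : ∀ r : I, ∃ t ∈ Icc 0 (dist x y), dist x (γ t) = r * dist x y := by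
    intro r
    have hc : ContinuousOn (fun t => dist x (γ t)) (Icc 0 (dist x y)) :=
      (continuous_const.dist continuous_id).comp_continuousOn h.continuousOn
    have := intermediate_value_Icc (dist_nonneg (x := x) (y := y)) hc
    refine this ⟨?_, ?_⟩
    · rw [h.source, dist_self]
      exact mul_nonneg r.2.1 dist_nonneg
    · rw [h.target]
      exact mul_le_of_le_one_left dist_nonneg r.2.2
  choose τ hτ hτd using hmem
  have hd : ∀ s t : I, dist (γ (τ s)) (γ (τ t)) = |(s : ℝ) - t| * dist x y := by
    intro s t
    rw [h.dist_eq_abs_sub (hτ s) (hτ t), hτd, hτd, ← sub_mul, abs_mul, abs_of_nonneg dist_nonneg]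
  have h0 : γ (τ 0) = x := by
    have := hτd 0
    simp only [Icc.coe_zero, zero_mul] at this
    exact (dist_eq_zero.1 this).symm
  have h1 : γ (τ 1) = y := by
    have := h.dist_eq_abs_sub (hτ 1) (right_mem_Icc.2 dist_nonneg)
    rw [hτd, h.target] at this
    simpa using this
  have hL : LipschitzWith (nndist x y) fun r : I => γ (τ r) :=
    LipschitzWith.of_dist_le_mul fun s t => by
      rw [hd, coe_nndist, mul_comm, Subtype.dist_eq, Real.dist_eq]
  exact ⟨⟨_, hL.continuous⟩, fun s t => by simp [hd, h0, h1], h0, h1⟩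

/-- The compact-open topology does not depend on the metric of `Y`, so a complete one may be chosen.
-/
instance ContinuousMap.polishSpace {K Y : Type*} [TopologicalSpace K] [CompactSpace K]
    [SecondCountableTopology K] [R1Space K] [TopologicalSpace Y] [PolishSpace Y] :
    PolishSpace C(K, Y) := by
  let _ := TopologicalSpace.upgradeIsCompletelyMetrizable Y
  infer_instance

/-- In a geodesic Polish space, constant-speed geodesics can be chosen measurably (up to null
sets) in their end points. -/
theorem IsGeodesicSpace.exists_aemeasurable_geodesic [PolishSpace X] [MeasurableSpace X]
    [BorelSpace X] (hX : IsGeodesicSpace X) (ν : Measure (X × X)) [IsFiniteMeasure ν] :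
    ∃ G : X → X → ℝ → X, (∀ T, AEMeasurable (fun z : X × X => G z.1 z.2 T) ν) ∧
      (∀ x y, G x y 0 = x) ∧ (∀ x y, G x y 1 = y) ∧
      (∀ x y, ∀ s ∈ Icc (0 : ℝ) 1, ∀ T ∈ Icc (0 : ℝ) 1,
        dist (G x y s) (G x y T) = |s - T| * dist x y) ∧
      ∀ x y T, dist x (G x y T) ≤ dist x y := by
  have : PolishSpace (constantSpeedGeodesics X) :=
    isClosed_constantSpeedGeodesics.polishSpace
  borelize C(I, X)
  -- Parametrizing all geodesics by `[0,1]` gathers them in one Polish space, on which the pair of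
  -- end points is a continuous map; it is onto because `X` is geodesic.
  obtain ⟨s, hs, hsec⟩ := exists_aemeasurable_section
    (Z := constantSpeedGeodesics X) (π := fun c => (c.1 0, c.1 1))
    (by fun_prop) (fun z => by
      obtain ⟨γ, hγ⟩ := hX z.1 z.2
      obtain ⟨c, hc, h0, h1⟩ := hγ.exists_mem_constantSpeedGeodesics
      exact ⟨⟨c, hc⟩, Prod.ext h0 h1⟩) ν
  have h0 : ∀ z, (s z).1 0 = z.1 := fun z => congrArg Prod.fst (hsec z)
  have h1 : ∀ z, (s z).1 1 = z.2 := fun z => congrArg Prod.snd (hsec z)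
  have hd : ∀ x y (a b : I), dist ((s (x, y)).1 a) ((s (x, y)).1 b) = |(a : ℝ) - b| * dist x y := by
    intro x y a b
    rw [(s (x, y)).2 a b, h0, h1]
  refine ⟨fun x y T => (s (x, y)).1 (projIcc 0 1 zero_le_one T), fun T => ?_, fun x y => ?_,
    fun x y => ?_, fun x y a ha b hb => ?_, fun x y T => ?_⟩
  · have hcont : Continuous fun c : constantSpeedGeodesics X =>
        c.1 (projIcc 0 1 zero_le_one T) := by fun_prop
    exact hcont.measurable.comp_aemeasurable hs
  · beta_reduce; rw [projIcc_left]; exact h0 _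
  · beta_reduce; rw [projIcc_right]; exact h1 _
  · rw [hd, projIcc_of_mem _ ha, projIcc_of_mem _ hb]
  · have h := hd x y 0 (projIcc 0 1 zero_le_one T)
    rw [h0] at h
    refine h.le.trans ?_
    refine mul_le_of_le_one_left dist_nonneg ?_
    rw [Icc.coe_zero, zero_sub, abs_neg, abs_of_nonneg (projIcc 0 1 zero_le_one T).2.1]
    exact (projIcc 0 1 zero_le_one T).2.2

/-- Nearest points of a closed set can be chosen measurably (up to null sets). -/
theorem exists_aemeasurable_nearest [PolishSpace X] [MeasurableSpace X] [BorelSpace X] {A : Set X}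
    (hA : IsClosed A) (hA' : ∀ x, ∃ y ∈ A, dist x y = Metric.infDist x A) (ν : Measure X)
    [IsFiniteMeasure ν] :
    ∃ r : X → X, AEMeasurable r ν ∧ ∀ x, r x ∈ A ∧ dist x (r x) = Metric.infDist x A := by
  let Z : Set (X × X) := {z | z.2 ∈ A ∧ dist z.1 z.2 = Metric.infDist z.1 A}
  have hZ : IsClosed Z := (hA.preimage continuous_snd).inter <| isClosed_eq (by fun_prop)
    ((Metric.continuous_infDist_pt A).comp continuous_fst)
  have : PolishSpace Z := hZ.polishSpace
  obtain ⟨s, hs, hsec⟩ := exists_aemeasurable_section (Z := Z) (π := fun z => z.1.1)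
    (by fun_prop) (fun x => by
      obtain ⟨y, hy, h⟩ := hA' x
      exact ⟨⟨(x, y), hy, h⟩, rfl⟩) ν
  refine ⟨fun x => (s x).1.2, ?_, fun x => ?_⟩
  · exact (measurable_snd.comp measurable_subtype_coe).comp_aemeasurable hs
  · have h := (s x).2
    have e : (s x).1.1 = x := hsec x
    refine ⟨h.1, ?_⟩
    have h2 := h.2
    rwa [e] at h2

end Geodesics

/-! ### Paths of subdivisions -/

namespace Subdivision

variable {E : Type*} [MetricSpace E] [MeasurableSpace E] {Δ : ℝ}

theorem measurePreserving_sub_right_Ioo (a : ℝ) :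
    MeasurePreserving (fun t : ℝ => t - a) (volume.restrict (Ioo a (a + Δ)))
      (volume.restrict (Ioo 0 Δ)) := by
  have h := (measurePreserving_sub_right (volume : Measure ℝ) a).restrict_preimage
    (s := Ioo 0 Δ) measurableSet_Ioo
  have e : (fun t : ℝ => t - a) ⁻¹' Ioo 0 Δ = Ioo a (a + Δ) := by
    ext t; simp [add_comm]
  rwa [e] at h

/-- The subdivision with left end point `a` whose value at `a + u` is `F u`. -/
def ofShifted (a : ℝ) (F : ℝ → E) (hF : AEMeasurable F (volume.restrict (Ioo 0 Δ)))
    (hb : Bornology.IsBounded (F '' Ioo 0 Δ)) : Subdivision E Δ where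
  start := a
  toFun t := F (t - a)
  measurable_toFun := (hF.comp_quasiMeasurePreserving
    (measurePreserving_sub_right_Ioo a).quasiMeasurePreserving).nullMeasurable
  bounded_toFun := by
    refine hb.subset ?_
    rintro _ ⟨t, ht, rfl⟩
    exact ⟨t - a, ⟨by linarith [ht.1], by linarith [ht.2]⟩, rfl⟩

/-- The end point conditions of `IsGeodesicPath` are equalities of structures, including values off
the interval. Since translation is a bijection of `ℝ`, the shifted map determines all of them. -/
theorem ext_shifted {ρ q : Subdivision E Δ} (h : ρ.start = q.start)
    (h' : ρ.shifted = q.shifted) : ρ = q := by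
  cases ρ with | mk a F _ _ =>
  cases q with | mk b G _ _ =>
  obtain rfl : a = b := h
  have : F = G := by
    ext t
    have := congrFun h' (t - a)
    simpa [shifted] using this
  subst this
  rfl

@[simp]
theorem ofShifted_start (a : ℝ) (F : ℝ → E) (hF hb) :
    (ofShifted (Δ := Δ) a F hF hb).start = a := rfl

@[simp]
theorem ofShifted_shifted (a : ℝ) (F : ℝ → E) (hF hb) :
    (ofShifted (Δ := Δ) a F hF hb).shifted = F := by
  ext u; simp [shifted, ofShifted]

theorem IsProjection.dist_shifted {A : Set E} {ρ p : Subdivision E Δ} (h : ρ.IsProjection A p) :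
    ∀ᵐ u ∂(volume.restrict (Ioo 0 Δ)), p.shifted u ∈ A ∧
      dist (ρ.shifted u) (p.shifted u) = Metric.infDist (ρ.shifted u) A := by
  have h2 : MeasurePreserving (fun u : ℝ => ρ.start + u)
      (volume.restrict (Ioo 0 Δ)) (volume.restrict (Ioo ρ.start (ρ.start + Δ))) := by
    have h := (measurePreserving_add_left (volume : Measure ℝ) ρ.start).restrict_preimage
      (s := Ioo ρ.start (ρ.start + Δ)) measurableSet_Ioo
    have e : (fun u : ℝ => ρ.start + u) ⁻¹' Ioo ρ.start (ρ.start + Δ) = Ioo 0 Δ := by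
      ext u; simp
    rwa [e] at h
  have := h2.quasiMeasurePreserving.ae h.2
  simpa only [shifted, h.1] using this

/-- The two intervals coincide, so the time-shift term vanishes and the integrands agree almost
everywhere. -/
theorem IsProjection.D_eq_DSet {A : Set E} {ρ p : Subdivision E Δ} (h : ρ.IsProjection A p)
    (α : ℝ) : ρ.D α p = ρ.DSet α A := by
  rw [D_eq, DSet_eq]
  refine integral_congr_ae ?_
  filter_upwards [h.dist_shifted] with u hu
  simp [hu.2, h.1]

theorem IsProjection.DSet_eq_zero {A : Set E} {ρ p : Subdivision E Δ} (h : ρ.IsProjection A p)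
    (α : ℝ) : p.DSet α A = 0 := by
  rw [DSet_eq]
  refine integral_eq_zero_of_ae ?_
  filter_upwards [h.dist_shifted] with u hu
  simp [Metric.infDist_zero_of_mem hu.1]

variable [BorelSpace E] [PolishSpace E]

/-- Subdivisions with values in a geodesic Polish space are joined by geodesic paths. -/
theorem exists_isGeodesicPath (hE : IsGeodesicSpace E) (α : ℝ) (ρ q : Subdivision E Δ) :
    ∃ g : ℝ → Subdivision E Δ, IsGeodesicPath α g ρ q := by
  have hm : AEMeasurable (fun u => (ρ.shifted u, q.shifted u)) (volume.restrict (Ioo 0 Δ)) :=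
    ρ.aemeasurable_shifted.prodMk q.aemeasurable_shifted
  -- Taking for measure the law of the pair of values makes the selected geodesic, composed with
  -- that pair, almost everywhere measurable in `u`.
  obtain ⟨G, hG, hG0, hG1, hGd, hGb⟩ := hE.exists_aemeasurable_geodesic
    ((volume.restrict (Ioo 0 Δ)).map fun u => (ρ.shifted u, q.shifted u))
  have hF : ∀ T, AEMeasurable (fun u => G (ρ.shifted u) (q.shifted u) T)
      (volume.restrict (Ioo 0 Δ)) := fun T => (hG T).comp_aemeasurable hm
  have hb : ∀ T, Bornology.IsBounded ((fun u => G (ρ.shifted u) (q.shifted u) T) '' Ioo 0 Δ) := by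
    intro T
    obtain ⟨C, hC⟩ := Metric.isBounded_iff.1 (ρ.isBounded_shifted.union q.isBounded_shifted)
    refine (ρ.isBounded_shifted.cthickening (δ := C)).subset ?_
    rintro _ ⟨u, hu, rfl⟩
    refine Metric.mem_cthickening_of_dist_le _ _ _ _ ⟨u, hu, rfl⟩ ?_
    rw [dist_comm]
    exact (hGb _ _ _).trans (hC (Or.inl ⟨u, hu, rfl⟩) (Or.inr ⟨u, hu, rfl⟩))
  let g : ℝ → Subdivision E Δ := fun T =>
    ofShifted ((1 - T) * ρ.start + T * q.start) _ (hF T) (hb T)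
  have hgs : ∀ T u, (g T).shifted u = G (ρ.shifted u) (q.shifted u) T := fun T u => by simp [g]
  refine ⟨g, ?_, ?_, fun s hs T hT => ?_, fun T _ => rfl, Filter.Eventually.of_forall ?_⟩
  · refine ext_shifted (by simp [g]) (funext fun u => ?_)
    rw [hgs, hG0]
  · refine ext_shifted (by simp [g]) (funext fun u => ?_)
    rw [hgs, hG1]
  -- Both the spatial term and the shift of the interval scale by `|s - T|`, so the integrand does
  -- too.
  · rw [D_eq, D_eq, ← integral_const_mul]
    congr 1
    ext u
    have e : |(g T).start - (g s).start| = |s - T| * |q.start - ρ.start| := by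
      rw [abs_sub_comm s T, ← abs_mul]
      congr 1
      simp only [g, ofShifted_start]
      ring
    rw [hgs, hgs, hGd _ _ s hs T hT, e]
    ring
  · intro u s hs T hT
    exact (congrArg₂ dist (hgs s u) (hgs T u)).trans (hGd _ _ s hs T hT)

/-- Subdivisions have nearest-point projections. -/
theorem exists_isProjection {A : Set E} (hA : IsClosed A)
    (hA' : ∀ x : E, ∃ y ∈ A, dist x y = Metric.infDist x A) (ρ : Subdivision E Δ) :
    ∃ p, ρ.IsProjection A p := by
  obtain ⟨r, hr, hrA⟩ := exists_aemeasurable_nearest hA hA'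
    ((volume.restrict (Ioo 0 Δ)).map ρ.shifted)
  -- Any point of `A` serves: a nearest point is no further from the value of `ρ` than `y`, which
  -- bounds the projection uniformly.
  obtain ⟨y, hy, -⟩ := hA' (ρ.toFun 0)
  have hb : Bornology.IsBounded ((fun u => r (ρ.shifted u)) '' Ioo 0 Δ) := by
    obtain ⟨C, hC⟩ := Metric.isBounded_iff.1
      (ρ.isBounded_shifted.union (Bornology.isBounded_singleton (x := y)))
    refine (ρ.isBounded_shifted.cthickening (δ := C)).subset ?_
    rintro _ ⟨u, hu, rfl⟩
    refine Metric.mem_cthickening_of_dist_le _ _ _ _ ⟨u, hu, rfl⟩ ?_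
    rw [dist_comm, (hrA _).2]
    exact (Metric.infDist_le_dist_of_mem hy).trans (hC (Or.inl ⟨u, hu, rfl⟩) (Or.inr rfl))
  refine ⟨ofShifted ρ.start _ (hr.comp_aemeasurable ρ.aemeasurable_shifted) hb, rfl,
    Filter.Eventually.of_forall fun t => ?_⟩
  have e : ρ.shifted (t - ρ.start) = ρ.toFun t := by simp [shifted]
  have h := hrA (ρ.toFun t)
  rw [← e] at h ⊢
  exact h

end Subdivision

/-! ### Concatenation of paths -/

section Concatenation

variable {X : Type*} [MetricSpace X]

/-- The Lipschitz bound gives length at most that of the interval, and the end points alone give the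
reverse inequality. -/
theorem isGeodesic_of_dist_le {x y : X} {γ : ℝ → X} (h0 : γ 0 = x) (h1 : γ (dist x y) = y)
    (h : ∀ s ∈ Icc 0 (dist x y), ∀ t ∈ Icc 0 (dist x y), dist (γ s) (γ t) ≤ |s - t|) :
    IsGeodesic x y γ := by
  have hL : LipschitzOnWith 1 γ (Icc 0 (dist x y)) :=
    LipschitzOnWith.of_dist_le_mul fun s hs t ht => by simpa [Real.dist_eq] using h s hs t ht
  refine ⟨hL.continuousOn, h0, h1, le_antisymm ?_ ?_⟩
  · have h2 := hL.comp_eVariationOn_le (g := id) (s := Icc 0 (dist x y)) (fun _ ht => ht)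
    have h3 := MonotoneOn.eVariationOn_eq (f := (id : ℝ → ℝ)) (s := Icc 0 (dist x y))
      (monotone_id.monotoneOn _) (left_mem_Icc.2 dist_nonneg) (right_mem_Icc.2 dist_nonneg)
    rw [inter_self] at h3
    simpa [h3] using h2
  · have h2 := eVariationOn.edist_le γ (left_mem_Icc.2 (dist_nonneg (x := x) (y := y)))
      (right_mem_Icc.2 (dist_nonneg (x := x) (y := y)))
    rwa [h0, h1, edist_dist] at h2

/-- A path on `[0,1]` run through on `[a, a + ℓ]`. -/
theorem exists_rescaled_path {c : ℝ → X} {ℓ : ℝ} (hℓ : 0 ≤ ℓ) (a : ℝ)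
    (hc : ∀ s ∈ Icc (0 : ℝ) 1, ∀ t ∈ Icc (0 : ℝ) 1, dist (c s) (c t) ≤ |s - t| * ℓ) :
    ∃ γ : ℝ → X, (∀ l, γ l = c ((l - a) / ℓ)) ∧ γ a = c 0 ∧ γ (a + ℓ) = c 1 ∧
      ∀ s ∈ Icc a (a + ℓ), ∀ t ∈ Icc a (a + ℓ), dist (γ s) (γ t) ≤ |s - t| := by
  have hmem : ∀ s ∈ Icc a (a + ℓ), (s - a) / ℓ ∈ Icc (0 : ℝ) 1 := fun s hs =>
    ⟨div_nonneg (by linarith [hs.1]) hℓ, div_le_one_of_le₀ (by linarith [hs.2]) hℓ⟩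
  refine ⟨fun l => c ((l - a) / ℓ), fun _ => rfl, by simp, ?_, fun s hs t ht => ?_⟩
  -- At zero speed `c` has equal ends, which is why reading `0 / 0` as `0` still reaches `c 1`.
  · rcases hℓ.eq_or_lt with rfl | hpos
    · have := hc 0 (by simp) 1 (by simp)
      rw [mul_zero] at this
      simpa using dist_le_zero.1 this
    · simp [hpos.ne']
  · refine (hc _ (hmem s hs) _ (hmem t ht)).trans ?_
    rw [← sub_div, sub_sub_sub_cancel_right, abs_div, abs_of_nonneg hℓ]
    rcases hℓ.eq_or_lt with rfl | hpos
    · simp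
    · rw [div_mul_cancel₀ _ hpos.ne']

theorem exists_glued_path {γ₁ γ₂ : ℝ → X} {a b d : ℝ} (h : γ₁ b = γ₂ b)
    (h₁ : ∀ s ∈ Icc a b, ∀ t ∈ Icc a b, dist (γ₁ s) (γ₁ t) ≤ |s - t|)
    (h₂ : ∀ s ∈ Icc b d, ∀ t ∈ Icc b d, dist (γ₂ s) (γ₂ t) ≤ |s - t|) :
    ∃ γ : ℝ → X, (∀ l ∈ Icc a b, γ l = γ₁ l) ∧ (∀ l ∈ Icc b d, γ l = γ₂ l) ∧
      ∀ s ∈ Icc a d, ∀ t ∈ Icc a d, dist (γ s) (γ t) ≤ |s - t| := by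
  classical
  let γ : ℝ → X := fun l => if l ≤ b then γ₁ l else γ₂ l
  have e₁ : ∀ l ≤ b, γ l = γ₁ l := fun l hl => if_pos hl
  have e₂ : ∀ l, b ≤ l → γ l = γ₂ l := by
    intro l hl
    rcases hl.eq_or_lt with rfl | hlt
    · rw [e₁ _ le_rfl, h]
    · exact if_neg hlt.not_ge
  have key : ∀ s t, a ≤ s → s ≤ t → t ≤ d → dist (γ s) (γ t) ≤ |s - t| := by
    intro s t has hst htd
    rcases le_total t b with htb | htb
    · rw [e₁ s (hst.trans htb), e₁ t htb]
      exact h₁ _ ⟨has, hst.trans htb⟩ _ ⟨has.trans hst, htb⟩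
    rcases le_total b s with hbs | hbs
    · rw [e₂ s hbs, e₂ t htb]
      exact h₂ _ ⟨hbs, hst.trans htd⟩ _ ⟨htb, htd⟩
    · rw [e₁ s hbs, e₂ t htb]
      have i₁ := h₁ s ⟨has, hbs⟩ b ⟨has.trans hbs, le_rfl⟩
      have i₂ := h₂ b ⟨le_rfl, htb.trans htd⟩ t ⟨htb, htd⟩
      have i₃ := dist_triangle (γ₁ s) (γ₁ b) (γ₂ t)
      rw [abs_of_nonpos (by linarith)] at i₁ i₂ ⊢
      rw [h] at i₁ i₃
      linarith
  refine ⟨γ, fun l hl => e₁ l hl.2, fun l hl => e₂ l hl.1, fun s hs t ht => ?_⟩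
  rcases le_total s t with hst | hst
  · exact key s t hs.1 hst ht.2
  · rw [dist_comm, abs_sub_comm]
    exact key t s ht.1 hst hs.2

/-- The concatenation of three paths of speeds `ℓ₁`, `ℓ₂` and `ℓ₃` is traversed at unit speed. -/
theorem exists_concatenation {c₁ c₂ c₃ : ℝ → X} {ℓ₁ ℓ₂ ℓ₃ : ℝ} (hℓ₁ : 0 ≤ ℓ₁) (hℓ₂ : 0 ≤ ℓ₂)
    (hℓ₃ : 0 ≤ ℓ₃)
    (hc₁ : ∀ s ∈ Icc (0 : ℝ) 1, ∀ t ∈ Icc (0 : ℝ) 1, dist (c₁ s) (c₁ t) ≤ |s - t| * ℓ₁)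
    (hc₂ : ∀ s ∈ Icc (0 : ℝ) 1, ∀ t ∈ Icc (0 : ℝ) 1, dist (c₂ s) (c₂ t) ≤ |s - t| * ℓ₂)
    (hc₃ : ∀ s ∈ Icc (0 : ℝ) 1, ∀ t ∈ Icc (0 : ℝ) 1, dist (c₃ s) (c₃ t) ≤ |s - t| * ℓ₃)
    (h₁₂ : c₁ 1 = c₂ 0) (h₂₃ : c₂ 1 = c₃ 0) :
    ∃ γ : ℝ → X, γ 0 = c₁ 0 ∧ γ (ℓ₁ + ℓ₂ + ℓ₃) = c₃ 1 ∧
      (∀ l ∈ Icc 0 ℓ₁, γ l = c₁ (l / ℓ₁)) ∧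
      (∀ l ∈ Icc ℓ₁ (ℓ₁ + ℓ₂), γ l = c₂ ((l - ℓ₁) / ℓ₂)) ∧
      (∀ l ∈ Icc (ℓ₁ + ℓ₂) (ℓ₁ + ℓ₂ + ℓ₃), γ l = c₃ ((l - (ℓ₁ + ℓ₂)) / ℓ₃)) ∧
      ∀ s ∈ Icc 0 (ℓ₁ + ℓ₂ + ℓ₃), ∀ t ∈ Icc 0 (ℓ₁ + ℓ₂ + ℓ₃), dist (γ s) (γ t) ≤ |s - t| := by
  obtain ⟨γ₁, e₁, a₁, b₁, L₁⟩ := exists_rescaled_path hℓ₁ 0 hc₁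
  obtain ⟨γ₂, e₂, a₂, b₂, L₂⟩ := exists_rescaled_path hℓ₂ ℓ₁ hc₂
  obtain ⟨γ₃, e₃, a₃, b₃, L₃⟩ := exists_rescaled_path hℓ₃ (ℓ₁ + ℓ₂) hc₃
  rw [zero_add] at b₁ L₁
  obtain ⟨γ', f₁, f₂, L'⟩ := exists_glued_path (by rw [b₁, a₂, h₁₂]) L₁ L₂
  have hmid : γ' (ℓ₁ + ℓ₂) = γ₃ (ℓ₁ + ℓ₂) := by
    rw [f₂ _ ⟨by linarith, le_rfl⟩, b₂, a₃, h₂₃]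
  obtain ⟨γ, k₁, k₂, L⟩ := exists_glued_path hmid L' L₃
  have g₁ : ∀ l ∈ Icc 0 ℓ₁, γ l = γ₁ l := fun l hl => by
    rw [k₁ l ⟨hl.1, by linarith [hl.2]⟩, f₁ l hl]
  refine ⟨γ, ?_, ?_, fun l hl => ?_, fun l hl => ?_, fun l hl => ?_, L⟩
  · rw [g₁ 0 ⟨le_rfl, hℓ₁⟩, a₁]
  · rw [k₂ _ ⟨by linarith, le_rfl⟩, b₃]
  · rw [g₁ l hl, e₁, sub_zero]
  · rw [k₁ l ⟨hℓ₁.trans hl.1, hl.2⟩, f₂ l hl, e₂]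
  · rw [k₂ l hl, e₃]

end Concatenation

/-! ### Stages of the delete, substitute, insert path -/

theorem Ioo_lt_Ioo_iff {Δ : ℝ} (hΔ : 0 < Δ) {a b : ℝ} :
    (∀ x ∈ Ioo a (a + Δ), ∀ y ∈ Ioo b (b + Δ), x < y) ↔ a + Δ ≤ b := by
  refine ⟨fun h => ?_, fun h x hx y hy => hx.2.trans_le (h.trans hy.1.le)⟩
  by_contra! hlt
  -- Moving inwards by `ε`, the first bound keeps both points inside their intervals, and the second
  -- keeps `b + ε ≤ a + Δ - ε`.
  have hε : 0 < min (Δ / 2) ((a + Δ - b) / 2) := lt_min (by linarith) (by linarith)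
  have h1 := min_le_left (Δ / 2) ((a + Δ - b) / 2)
  have h2 := min_le_right (Δ / 2) ((a + Δ - b) / 2)
  have := h (a + Δ - min (Δ / 2) ((a + Δ - b) / 2)) ⟨by linarith, by linarith⟩
    (b + min (Δ / 2) ((a + Δ - b) / 2)) ⟨by linarith, by linarith⟩
  linarith

namespace PartialAssignment

variable {n m : ℕ}

theorem mem_dom {f : PartialAssignment n m} {i : Fin n} :
    i ∈ f.dom ↔ ∃ j, (i, j) ∈ f.graph := by
  simp [dom]

theorem mem_im {f : PartialAssignment n m} {j : Fin m} :
    j ∈ f.im ↔ ∃ i, (i, j) ∈ f.graph := by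
  simp [im]

/-- The pairs of a partial assignment, listed from left to right. -/
theorem exists_enumeration (f : PartialAssignment n m) :
    ∃ (k : ℕ) (e : Fin k → Fin n × Fin m), StrictMono (fun i => (e i).1) ∧
      StrictMono (fun i => (e i).2) ∧ Set.range e = (f.graph : Set (Fin n × Fin m)) := by
  let o := f.dom.orderEmbOfFin rfl
  have ho : ∀ k, ∃ j, (o k, j) ∈ f.graph := fun k =>
    mem_dom.1 (f.dom.orderEmbOfFin_mem rfl k)
  choose j hj using ho
  refine ⟨_, fun k => (o k, j k), o.strictMono,
    fun a b hab => f.strictMono _ (hj a) _ (hj b) (o.strictMono hab), ?_⟩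
  ext x
  constructor
  · rintro ⟨k, rfl⟩
    exact hj k
  · intro hx
    have h1 : x.1 ∈ Set.range o := by
      rw [Finset.range_orderEmbOfFin]
      exact mem_dom.2 ⟨x.2, hx⟩
    obtain ⟨k, hk⟩ := h1
    exact ⟨k, Prod.ext hk (f.functional _ (hj k) _ hx hk)⟩

/-- The partial assignment inverse to a strictly increasing map. -/
def ofStrictMono (j : Fin m → Fin n) (hj : StrictMono j) : PartialAssignment n m where
  graph := Finset.univ.image fun k => (j k, k)
  functional := by
    simp only [Finset.mem_image, Finset.mem_univ, true_and]
    rintro _ ⟨a, rfl⟩ _ ⟨b, rfl⟩ h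
    exact hj.injective h
  strictMono := by
    simp only [Finset.mem_image, Finset.mem_univ, true_and]
    rintro _ ⟨a, rfl⟩ _ ⟨b, rfl⟩ h
    exact hj.lt_iff_lt.1 h

variable {E : Type*} [MetricSpace E] [MeasurableSpace E] {Δ : ℝ}

theorem cost_ofStrictMono {α β : ℝ} (A : Set E) {P Q : TVPD E Δ} (j : Fin Q.N → Fin P.N)
    (hj : StrictMono j) : (ofStrictMono j hj).cost (P := P) (Q := Q) α β A =
      ∑ k, (P.sub (j k)).D α (Q.sub k) +
        β * ∑ i ∈ Finset.univ \ Finset.univ.image j, (P.sub i).DSet α A := by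
  have h1 : (ofStrictMono j hj).dom = Finset.univ.image j := by ext; simp [ofStrictMono, dom]
  have h2 : (ofStrictMono j hj).im = Finset.univ := by ext; simp [ofStrictMono, im]
  have h3 : (ofStrictMono j hj).substitutionCost (P := P) (Q := Q) α =
      ∑ k, (P.sub (j k)).D α (Q.sub k) := by
    unfold substitutionCost
    simp only [ofStrictMono]
    rw [Finset.sum_image fun a _ b _ h => congrArg Prod.snd h]
  simp [cost, deletionCost, insertionCost, h1, h2, h3]

/-- The empty assignment. -/
def empty (n m : ℕ) : PartialAssignment n m := ⟨∅, by simp, by simp⟩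

end PartialAssignment

namespace TVPDSpace

variable {E : Type*} [MetricSpace E] [MeasurableSpace E] [BorelSpace E]
  [SecondCountableTopology E] {Δ : ℝ} {A : Set E} {α β : ℝ}
  {hα : α ∈ Ioo (0 : ℝ) 1} {hβ : β ∈ Ioc (0 : ℝ) 1}

/-- Subdivisions at distance zero from `A` can be dropped. -/
theorem mk_eq_mk_of_drop {P Q : TVPD E Δ} (j : Fin Q.N → Fin P.N) (hj : StrictMono j)
    (hD : ∀ k, P.sub (j k) = Q.sub k) (hA : ∀ i, i ∉ Set.range j → (P.sub i).DSet α A = 0) :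
    (mk P : TVPDSpace Δ A hα hβ) = mk Q := by
  rw [← dist_le_zero, dist_mk]
  refine (CED_le α β A (PartialAssignment.ofStrictMono j hj)).trans ?_
  rw [PartialAssignment.cost_ofStrictMono, Finset.sum_eq_zero, Finset.sum_eq_zero]
  · simp
  · intro i hi
    exact hA i (by simpa using hi)
  · intro k _
    rw [hD, Subdivision.D_self]

/-- This replaces dropping when nothing is matched: diagrams have at least one interval, so there is
no empty diagram to pass through, and the empty assignment compares the two sides directly. -/
theorem mk_eq_mk_of_forall_DSet_eq_zero {P Q : TVPD E Δ} (hP : ∀ i, (P.sub i).DSet α A = 0)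
    (hQ : ∀ i, (Q.sub i).DSet α A = 0) : (mk P : TVPDSpace Δ A hα hβ) = mk Q := by
  rw [← dist_le_zero, dist_mk]
  refine (CED_le α β A (PartialAssignment.empty P.N Q.N)).trans ?_
  simp [PartialAssignment.cost, PartialAssignment.substitutionCost, PartialAssignment.deletionCost,
    PartialAssignment.insertionCost, PartialAssignment.empty, hP, hQ]

/-- Moving the subdivisions of a diagram moves its class at most at the total speed. -/
theorem exists_path_of_sum_D_le {n : ℕ} (hn : 1 ≤ n) (S : ℝ → Fin n → Subdivision E Δ)
    (hord : ∀ T ∈ Icc (0 : ℝ) 1, ∀ i i' : Fin n, i < i' →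
      ∀ x ∈ Ioo (S T i).start ((S T i).start + Δ),
      ∀ x' ∈ Ioo (S T i').start ((S T i').start + Δ), x < x') {ℓ : ℝ}
    (hS : ∀ s ∈ Icc (0 : ℝ) 1, ∀ T ∈ Icc (0 : ℝ) 1, ∑ i, (S s i).D α (S T i) ≤ |s - T| * ℓ) :
    ∃ c : ℝ → TVPDSpace Δ A hα hβ,
      (∀ T, ∀ hT : T ∈ Icc (0 : ℝ) 1, c T = mk ⟨n, hn, S T, hord T hT⟩) ∧
      ∀ s ∈ Icc (0 : ℝ) 1, ∀ T ∈ Icc (0 : ℝ) 1, dist (c s) (c T) ≤ |s - T| * ℓ := by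
  classical
  let c : ℝ → TVPDSpace Δ A hα hβ := fun T =>
    if hT : T ∈ Icc (0 : ℝ) 1 then mk ⟨n, hn, S T, hord T hT⟩
    else mk ⟨n, hn, S 0, hord 0 (by simp)⟩
  have hc : ∀ T, ∀ hT : T ∈ Icc (0 : ℝ) 1, c T = mk ⟨n, hn, S T, hord T hT⟩ := fun T hT =>
    dif_pos hT
  refine ⟨c, hc, fun s hs T hT => ?_⟩
  rw [hc s hs, hc T hT, dist_mk]
  let P : TVPD E Δ := ⟨n, hn, S s, hord s hs⟩
  let Q : TVPD E Δ := ⟨n, hn, S T, hord T hT⟩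
  let j : Fin Q.N → Fin P.N := id
  have hj : StrictMono j := strictMono_id
  refine (CED_le (P := P) (Q := Q) α β A (PartialAssignment.ofStrictMono j hj)).trans ?_
  have himg : Finset.univ.image j = Finset.univ := Finset.image_id
  rw [PartialAssignment.cost_ofStrictMono, himg, Finset.sdiff_self, Finset.sum_empty, mul_zero,
    add_zero]
  exact hS s hs T hT

/-- The path which moves the subdivisions outside `K` along geodesic paths on fixed intervals. -/
theorem exists_path_of_keep (P : TVPD E Δ) (K : Finset (Fin P.N))
    {a b : Fin P.N → Subdivision E Δ} {g : Fin P.N → ℝ → Subdivision E Δ}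
    (hg : ∀ i ∉ K, Subdivision.IsGeodesicPath α (g i) (a i) (b i))
    (ha : ∀ i ∉ K, (a i).start = (P.sub i).start) (hb : ∀ i ∉ K, (b i).start = (P.sub i).start)
    (hab : ∀ i ∉ K, (a i).D α (b i) = (P.sub i).DSet α A) :
    ∃ (c : ℝ → TVPDSpace Δ A hα hβ) (hord : ∀ T ∈ Icc (0 : ℝ) 1, ∀ i i' : Fin P.N, i < i' →
        ∀ x ∈ Ioo (if i ∈ K then P.sub i else g i T).start
          ((if i ∈ K then P.sub i else g i T).start + Δ),
        ∀ x' ∈ Ioo (if i' ∈ K then P.sub i' else g i' T).start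
          ((if i' ∈ K then P.sub i' else g i' T).start + Δ), x < x'),
      (∀ T, ∀ hT : T ∈ Icc (0 : ℝ) 1, c T = mk ⟨P.N, P.one_le_N,
        fun i => if i ∈ K then P.sub i else g i T, hord T hT⟩) ∧
      ∀ s ∈ Icc (0 : ℝ) 1, ∀ T ∈ Icc (0 : ℝ) 1, dist (c s) (c T) ≤
        |s - T| * ∑ i ∈ Finset.univ \ K, (P.sub i).DSet α A := by
  have hst : ∀ T ∈ Icc (0 : ℝ) 1, ∀ i,
      (if i ∈ K then P.sub i else g i T).start = (P.sub i).start := by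
    intro T hT i
    split_ifs with hi
    · rfl
    · rw [(hg i hi).start_eq T hT, ha i hi, hb i hi]
      ring
  have hord : ∀ T ∈ Icc (0 : ℝ) 1, ∀ i i' : Fin P.N, i < i' →
        ∀ x ∈ Ioo (if i ∈ K then P.sub i else g i T).start
          ((if i ∈ K then P.sub i else g i T).start + Δ),
        ∀ x' ∈ Ioo (if i' ∈ K then P.sub i' else g i' T).start
          ((if i' ∈ K then P.sub i' else g i' T).start + Δ), x < x' := by
    intro T hT i i' h
    rw [hst T hT, hst T hT]
    exact P.ordered i i' h
  obtain ⟨c, hc, hd⟩ := exists_path_of_sum_D_le (A := A) (hα := hα) (hβ := hβ)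
    (ℓ := ∑ i ∈ Finset.univ \ K, (P.sub i).DSet α A) P.one_le_N
    (fun T i => if i ∈ K then P.sub i else g i T) hord (by
      intro s hs T hT
      rw [Finset.mul_sum]
      refine le_of_eq ?_
      rw [← Finset.sum_subset (Finset.subset_univ (Finset.univ \ K))]
      · refine Finset.sum_congr rfl fun i hi => ?_
        have hi' : i ∉ K := by simpa using hi
        rw [if_neg hi', if_neg hi', (hg i hi').speed s hs T hT, hab i hi']
      · intro i _ hi
        have hi' : i ∈ K := by simpa using hi
        rw [if_pos hi', if_pos hi', Subdivision.D_self])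
  exact ⟨c, hord, hc, hd⟩

/-- The path which moves `n` matched pairs of subdivisions along geodesic paths. -/
theorem exists_path_of_match (hΔ : 0 < Δ) (P Q : TVPD E Δ) {n : ℕ} (hn : 1 ≤ n)
    (e : Fin n → Fin P.N × Fin Q.N) (h1 : StrictMono fun k => (e k).1)
    (h2 : StrictMono fun k => (e k).2) {g : Fin P.N × Fin Q.N → ℝ → Subdivision E Δ}
    (hg : ∀ k, Subdivision.IsGeodesicPath α (g (e k)) (P.sub (e k).1) (Q.sub (e k).2)) :
    ∃ (c : ℝ → TVPDSpace Δ A hα hβ) (hord : ∀ T ∈ Icc (0 : ℝ) 1, ∀ i i' : Fin n, i < i' →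
        ∀ x ∈ Ioo (g (e i) T).start ((g (e i) T).start + Δ),
        ∀ x' ∈ Ioo (g (e i') T).start ((g (e i') T).start + Δ), x < x'),
      (∀ T, ∀ hT : T ∈ Icc (0 : ℝ) 1, c T = mk ⟨n, hn, fun k => g (e k) T, hord T hT⟩) ∧
      ∀ s ∈ Icc (0 : ℝ) 1, ∀ T ∈ Icc (0 : ℝ) 1, dist (c s) (c T) ≤
        |s - T| * ∑ k, (P.sub (e k).1).D α (Q.sub (e k).2) := by
  have hord : ∀ T ∈ Icc (0 : ℝ) 1, ∀ i i' : Fin n, i < i' →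
        ∀ x ∈ Ioo (g (e i) T).start ((g (e i) T).start + Δ),
        ∀ x' ∈ Ioo (g (e i') T).start ((g (e i') T).start + Δ), x < x' := by
    intro T hT i i' h
    -- The order at time `T` is the convex combination of the order inequalities in `P` and in `Q`;
    -- monotonicity of the matching is what supplies both.
    rw [Ioo_lt_Ioo_iff hΔ, (hg i).start_eq T hT, (hg i').start_eq T hT]
    have i1 := (Ioo_lt_Ioo_iff hΔ).1 (P.ordered _ _ (h1 h))
    have i2 := (Ioo_lt_Ioo_iff hΔ).1 (Q.ordered _ _ (h2 h))
    have j1 := mul_le_mul_of_nonneg_left i1 (sub_nonneg.2 hT.2)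
    have j2 := mul_le_mul_of_nonneg_left i2 hT.1
    linarith
  obtain ⟨c, hc, hd⟩ := exists_path_of_sum_D_le (A := A) (hα := hα) (hβ := hβ)
    (ℓ := ∑ k, (P.sub (e k).1).D α (Q.sub (e k).2)) hn (fun T k => g (e k) T) hord (by
      intro s hs T hT
      rw [Finset.mul_sum]
      exact Finset.sum_le_sum fun k _ => ((hg k).speed s hs T hT).le)
  exact ⟨c, hord, hc, hd⟩

end TVPDSpace

/-! ### The geodesic of an optimal assignment -/

theorem TVPD.mk_eq_of_sub_eq {E : Type*} [MetricSpace E] [MeasurableSpace E] {Δ : ℝ}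
    (P : TVPD E Δ) {s : Fin P.N → Subdivision E Δ} (h : s = P.sub) (hord) :
    (⟨P.N, P.one_le_N, s, hord⟩ : TVPD E Δ) = P := by
  subst h
  rfl

/-- Every optimal partial assignment gives a delete, substitute, insert geodesic. -/
theorem TVPDSpace.exists_isGeodesic_isDeleteSubstituteInsert {E : Type*} [MetricSpace E]
    [PolishSpace E] [MeasurableSpace E] [BorelSpace E] (hE : IsGeodesicSpace E) {A : Set E}
    (hA : IsClosed A) (hA' : ∀ x : E, ∃ y ∈ A, dist x y = Metric.infDist x A) {Δ : ℝ}
    (hΔ : 0 < Δ) {α : ℝ} (hα : α ∈ Set.Ioo (0 : ℝ) 1) (P Q : TVPD E Δ)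
    (f : PartialAssignment P.N Q.N) (hf : f.cost α 1 A = CED α 1 A P Q) :
    ∃ γ : ℝ → TVPDSpace Δ A hα one_mem_Ioc_zero_one,
      IsGeodesic (TVPDSpace.mk P) (TVPDSpace.mk Q) γ ∧
      TVPDSpace.IsDeleteSubstituteInsert P Q f γ := by
  choose p hp using fun i => Subdivision.exists_isProjection hA hA' (P.sub i)
  choose q hq using fun j => Subdivision.exists_isProjection hA hA' (Q.sub j)
  choose gDel hDel using fun i => Subdivision.exists_isGeodesicPath hE α (P.sub i) (p i)
  choose gIns hIns using fun j => Subdivision.exists_isGeodesicPath hE α (q j) (Q.sub j)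
  choose gSub hSub using fun x : Fin P.N × Fin Q.N =>
    Subdivision.exists_isGeodesicPath hE α (P.sub x.1) (Q.sub x.2)
  have h0 : (0 : ℝ) ∈ Icc (0 : ℝ) 1 := by simp
  have h1 : (1 : ℝ) ∈ Icc (0 : ℝ) 1 := by simp
  obtain ⟨c₁, ord₁, hc₁, hd₁⟩ := exists_path_of_keep (A := A) (hα := hα)
    (hβ := one_mem_Ioc_zero_one) P f.dom (fun i _ => hDel i) (fun _ _ => rfl)
    (fun i _ => (hp i).1) (fun i _ => (hp i).D_eq_DSet α)
  obtain ⟨c₃, ord₃, hc₃, hd₃⟩ := exists_path_of_keep (A := A) (hα := hα)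
    (hβ := one_mem_Ioc_zero_one) Q f.im (fun j _ => hIns j) (fun j _ => (hq j).1)
    (fun _ _ => rfl) (fun j _ => by rw [Subdivision.D_comm, (hq j).D_eq_DSet α])
  obtain ⟨n, e, he₁, he₂, hrange⟩ := f.exists_enumeration
  have hmem : ∀ k, e k ∈ f.graph := fun k => by
    rw [← Finset.mem_coe, ← hrange]
    exact mem_range_self k
  have hsum : ∑ k, (P.sub (e k).1).D α (Q.sub (e k).2) = f.substitutionCost α := by
    have himg : f.graph = Finset.univ.image e := by
      rw [← Finset.coe_inj, ← hrange]
      simp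
    unfold PartialAssignment.substitutionCost
    rw [himg, Finset.sum_image fun a _ b _ h => he₁.injective (congrArg Prod.fst h)]
  have hdom : ∀ i ∈ f.dom, ∃ k, (e k).1 = i := fun i hi => by
    obtain ⟨j, hj⟩ := PartialAssignment.mem_dom.1 hi
    obtain ⟨k, hk⟩ := hrange.symm.subset hj
    exact ⟨k, by rw [hk]⟩
  have him : ∀ j ∈ f.im, ∃ k, (e k).2 = j := fun j hj => by
    obtain ⟨i, hi⟩ := PartialAssignment.mem_im.1 hj
    obtain ⟨k, hk⟩ := hrange.symm.subset hi
    exact ⟨k, by rw [hk]⟩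
  have hdom' : ∀ k, (e k).1 ∈ f.dom := fun k => PartialAssignment.mem_dom.2 ⟨_, hmem k⟩
  have him' : ∀ k, (e k).2 ∈ f.im := fun k => PartialAssignment.mem_im.2 ⟨_, hmem k⟩
  have hL₁ : 0 ≤ f.deletionCost α A := Finset.sum_nonneg fun _ _ => Subdivision.DSet_nonneg hα _ _
  have hL₂ : 0 ≤ f.substitutionCost α := Finset.sum_nonneg fun _ _ => Subdivision.D_nonneg hα _ _
  have hL₃ : 0 ≤ f.insertionCost α A :=
    Finset.sum_nonneg fun _ _ => Subdivision.DSet_nonneg hα _ _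
  -- If nothing is matched, the second stage is constant and joins two diagrams all of whose
  -- subdivisions are at distance zero from `A`. Otherwise the projected subdivisions are dropped at
  -- its start and added at its end.
  have middle : ∃ c₂ : ℝ → TVPDSpace Δ A hα one_mem_Ioc_zero_one,
      c₁ 1 = c₂ 0 ∧ c₂ 1 = c₃ 0 ∧
      (∀ s ∈ Icc (0 : ℝ) 1, ∀ T ∈ Icc (0 : ℝ) 1,
        dist (c₂ s) (c₂ T) ≤ |s - T| * f.substitutionCost α) ∧
      (f.graph.Nonempty → ∀ T ∈ Icc (0 : ℝ) 1, ∃ R : TVPD E Δ, c₂ T = mk R ∧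
        R.IsListing f.graph fun x => gSub x T) := by
    rcases Nat.eq_zero_or_pos n with rfl | hn
    · have hdom0 : ∀ i, i ∉ f.dom := fun i hi => (hdom i hi).choose.elim0
      have him0 : ∀ j, j ∉ f.im := fun j hj => (him j hj).choose.elim0
      refine ⟨fun _ => c₁ 1, rfl, ?_, fun s _ T _ => ?_, fun ⟨x, hx⟩ => ?_⟩
      · rw [hc₁ 1 h1, hc₃ 0 h0]
        refine mk_eq_mk_of_forall_DSet_eq_zero (fun i => ?_) (fun j => ?_)
        · simp only [if_neg (hdom0 i), (hDel i).target, (hp i).DSet_eq_zero]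
        · simp only [if_neg (him0 j), (hIns j).source, (hq j).DSet_eq_zero]
      · rw [dist_self]
        positivity
      · exact absurd (PartialAssignment.mem_dom.2 ⟨_, hx⟩) (hdom0 x.1)
    · obtain ⟨c₂, ord₂, hc₂, hd₂⟩ := exists_path_of_match (A := A) (hα := hα)
        (hβ := one_mem_Ioc_zero_one) hΔ P Q hn e he₁ he₂ (fun k => hSub (e k))
      rw [hsum] at hd₂
      refine ⟨c₂, ?_, ?_, hd₂, fun _ T hT => ⟨_, hc₂ T hT, e, ?_, hrange, fun _ => rfl⟩⟩
      · rw [hc₁ 1 h1, hc₂ 0 h0]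
        refine mk_eq_mk_of_drop (fun k => (e k).1) he₁ (fun k => ?_) (fun i hi => ?_)
        · simp only [if_pos (hdom' k), (hSub (e k)).source]
        · have hi' : i ∉ f.dom := fun h => hi (hdom i h)
          simp only [if_neg hi', (hDel i).target, (hp i).DSet_eq_zero]
      · rw [hc₂ 1 h1, hc₃ 0 h0]
        refine Eq.symm ?_
        refine mk_eq_mk_of_drop (fun k => (e k).2) he₂ (fun k => ?_) (fun j hj => ?_)
        · simp only [if_pos (him' k), (hSub (e k)).target]
        · have hj' : j ∉ f.im := fun h => hj (him j h)
          simp only [if_neg hj', (hIns j).source, (hq j).DSet_eq_zero]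
      · exact fun a b hab => Prod.mk_lt_mk_of_lt_of_le (he₁ hab) (he₂ hab).le
  obtain ⟨c₂, h₁₂, h₂₃, hd₂, hc₂⟩ := middle
  obtain ⟨γ, hγ0, hγ1, s₁, s₂, s₃, hL⟩ :=
    exists_concatenation hL₁ hL₂ hL₃ hd₁ hd₂ hd₃ h₁₂ h₂₃
  -- This is where optimality of `f` enters. The weight `β = 1` matters too: the path pays the full
  -- distance to `A` for each deletion and insertion.
  have hdist : dist (mk P : TVPDSpace Δ A hα one_mem_Ioc_zero_one) (mk Q) =
      f.deletionCost α A + f.substitutionCost α + f.insertionCost α A := by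
    rw [dist_mk, ← hf, PartialAssignment.cost]
    ring
  have hP : γ 0 = mk P := by
    rw [hγ0, hc₁ 0 h0, TVPD.mk_eq_of_sub_eq]
    ext1 i
    simp only [(hDel i).source, ite_self]
  have hQ : γ (f.deletionCost α A + f.substitutionCost α + f.insertionCost α A) = mk Q := by
    rw [hγ1, hc₃ 1 h1, TVPD.mk_eq_of_sub_eq]
    ext1 j
    simp only [(hIns j).target, ite_self]
  refine ⟨γ, isGeodesic_of_dist_le hP (by rw [hdist, hQ]) (by rwa [hdist]), p, q, gDel, gSub, gIns,
    fun i _ => ⟨hp i, hDel i⟩, fun x _ => hSub x, fun j _ => ⟨hq j, hIns j⟩,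
    fun l hl => ?_, fun hne l hl => ?_, fun l hl => ?_⟩
  · have hT : l / f.deletionCost α A ∈ Icc (0 : ℝ) 1 :=
      ⟨div_nonneg hl.1 hL₁, div_le_one_of_le₀ hl.2 hL₁⟩
    exact ⟨_, (s₁ l hl).trans (hc₁ _ hT), id, strictMono_id, by simp, fun _ => rfl⟩
  · rw [add_sub_cancel_left, s₂ l hl]
    exact hc₂ hne _ ⟨div_nonneg (by linarith [hl.1]) hL₂,
      div_le_one_of_le₀ (by linarith [hl.2]) hL₂⟩
  · rw [add_sub_cancel_left]
    have hT : (l - (f.deletionCost α A + f.substitutionCost α)) / f.insertionCost α A ∈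
        Icc (0 : ℝ) 1 :=
      ⟨div_nonneg (by linarith [hl.1]) hL₃, div_le_one_of_le₀ (by linarith [hl.2]) hL₃⟩
    exact ⟨_, (s₃ l hl).trans (hc₃ _ hT), id, strictMono_id, by simp, fun _ => rfl⟩

theorem mainTheorem2 {E : Type*} [MetricSpace E] [PolishSpace E] [MeasurableSpace E] [BorelSpace E]
    (hE : IsGeodesicSpace E) (A : Set E) (hA : A ⊂ Set.univ) (hA_closed : IsClosed A)
    (hA_nearest : ∀ x : E, ∃ y ∈ A, dist x y = Metric.infDist x A)
    (Δ : ℝ) (hΔ : 0 < Δ) (α : ℝ) (hα : α ∈ Set.Ioo (0 : ℝ) 1) :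
    IsGeodesicSpace (TVPDSpace Δ A hα one_mem_Ioc_zero_one) ∧
    ∀ (P Q : TVPD E Δ) (f : PartialAssignment P.N Q.N),
      f.cost α 1 A = CED α 1 A P Q →
      ∃ γ : ℝ → TVPDSpace Δ A hα one_mem_Ioc_zero_one,
        IsGeodesic (TVPDSpace.mk P) (TVPDSpace.mk Q) γ ∧
        TVPDSpace.IsDeleteSubstituteInsert P Q f γ := by
  have key := fun P Q f hf => TVPDSpace.exists_isGeodesic_isDeleteSubstituteInsert hE hA_closed
    hA_nearest hΔ hα P Q f hf
  refine ⟨fun x y => ?_, key⟩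
  obtain ⟨P, rfl⟩ := TVPDSpace.mk_surjective x
  obtain ⟨Q, rfl⟩ := TVPDSpace.mk_surjective y
  obtain ⟨f, hf⟩ := exists_cost_eq_CED α 1 A P Q
  obtain ⟨γ, hγ, -⟩ := key P Q f hf
  exact ⟨γ, hγ⟩
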